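/- Let $X$ be a noetherian normal integral scheme with function field $K$ and generic point $\eta=\operatorname{Spec}K$. Assume that for every closed point $x\in X$ the completion $\widehat{\mathcal O}_{X,x}$ of the local ring $\mathcal O_{X,x}$ at its maximal ideal is a normal domain, and that for every finite separable extension $L/K$ the normalization of $X$ in $L$ has the same property (the completed local rings at all of its closed points are normal domains). Let $\overline K$ be an algebraic closure of $K$, let $\overline\eta$ be the geometric point $\operatorname{Spec}\overline K\to X$ over $\eta$, and let $$\phi:\operatorname{Gal}(\overline K/K)\to\pi_1(X,\overline\eta)$$ be the canonical homomorphism, where $\operatorname{Gal}$ denotes the automorphism group with the Krull topology and $\pi_1$ is the étale fundamental group, i.e. the automorphism group of the fibre functor on finite étale covers. For every closed point $x\in X$ let $K_x$ be the fraction field of $\widehat{\mathcal O}_{X,x}$, let $\overline K_x$ be an algebraic closure of $K_x$, let $\overline\eta_x$ be the geometric point $\operatorname{Spec}\overline K_x\to\operatorname{Spec}\widehat{\mathcal O}_{X,x}$, and fix an embedding $\omega_x:\overline K\to\overline K_x$ extending the canonical embedding $K\to K_x$. Let $$\psi_x:\operatorname{Gal}(\overline K_x/K_x)\to\operatorname{Gal}(\overline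 K/K)$$ be the restriction homomorphism along $\omega_x$, and let $$\phi_x:\operatorname{Gal}(\overline K_x/K_x)\to\pi_1(\operatorname{Spec}\widehat{\mathcal O}_{X,x},\overline\eta_x)$$ be the canonical homomorphism. Then $\ker\phi=H$, where $H$ is the closed normal subgroup of $\operatorname{Gal}(\overline K/K)$ generated by the subgroups $\psi_x(\ker\phi_x)$, for $x$ running over all closed points of $X$. -/

import Mathlib

open CategoryTheory AlgebraicGeometry

universe u

namespace LocalKernels

noncomputable section

/-! ### The étale fundamental group -/

/-- The category of finite étale schemes over `X`, with all morphisms over `X`. -/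
abbrev FiniteEtaleOver (X : Scheme.{u}) : Type (u + 1) :=
  MorphismProperty.Over (@IsFinite ⊓ @Etale : MorphismProperty Scheme.{u}) ⊤ X

/-- The fibre functor `Y ↦ Hom_X(Spec Ω, Y)` at a geometric point `s : Spec Ω ⟶ X`. -/
abbrev fibreFunctor {X : Scheme.{u}} {Ω : Type u} [Field Ω] (s : Spec (.of Ω) ⟶ X) :
    FiniteEtaleOver X ⥤ Type u :=
  MorphismProperty.Over.forget _ _ X ⋙ coyoneda.obj (Opposite.op (Over.mk s))

/-- The étale fundamental group `π₁(X, s)`: the automorphism group of the fibre functor at `s`. -/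
abbrev EtalePi1 {X : Scheme.{u}} {Ω : Type u} [Field Ω] (s : Spec (.of Ω) ⟶ X) : Type (u + 1) :=
  Aut (fibreFunctor s)

section GaloisToPi1

variable {X : Scheme.{u}} {k : Type u} [Field k] (f : Spec (.of k) ⟶ X)
  (Ω : Type u) [Field Ω] [Algebra k Ω]

/-- The geometric point `Spec Ω ⟶ Spec k ⟶ X`. -/
def geometricPoint : Spec (.of Ω) ⟶ X :=
  Spec.map (CommRingCat.ofHom (algebraMap k Ω)) ≫ f

/-- The morphism `Spec σ`, as an endomorphism over `X` of the geometric point. -/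
def specGal (σ : Gal(Ω/k)) :
    Over.mk (geometricPoint f Ω) ⟶ Over.mk (geometricPoint f Ω) :=
  Over.homMk (Spec.map (CommRingCat.ofHom (σ : Ω →+* Ω))) (by
    dsimp only [geometricPoint, Over.mk_left, Over.mk_hom]
    rw [← Category.assoc, ← Spec.map_comp, ← CommRingCat.ofHom_comp]
    congr 3
    ext a
    exact σ.commutes a)

lemma specGal_one : specGal f Ω 1 = 𝟙 _ := by
  ext1
  exact Spec.map_id _

lemma specGal_mul (σ τ : Gal(Ω/k)) :
    specGal f Ω (σ * τ) = specGal f Ω σ ≫ specGal f Ω τ := by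
  ext1
  exact Spec.map_comp (CommRingCat.ofHom (τ : Ω →+* Ω)) (CommRingCat.ofHom (σ : Ω →+* Ω))

/-- The automorphism of the geometric point over `X` given by `σ ∈ Gal(Ω/k)`. -/
def specGalIso (σ : Gal(Ω/k)) :
    Over.mk (geometricPoint f Ω) ≅ Over.mk (geometricPoint f Ω) where
  hom := specGal f Ω σ
  inv := specGal f Ω σ⁻¹
  hom_inv_id := by rw [← specGal_mul, mul_inv_cancel, specGal_one]
  inv_hom_id := by rw [← specGal_mul, inv_mul_cancel, specGal_one]

/-- The canonical homomorphism `Gal(Ω/k) → π₁(X, Spec Ω)` attached to `Spec k ⟶ X`: the element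
`σ` sends a point `y : Spec Ω ⟶ Y` of the fibre to `Spec σ ≫ y`. -/
def galToPi1 : Gal(Ω/k) →* EtalePi1 (geometricPoint f Ω) where
  toFun σ := Functor.isoWhiskerLeft _ (coyoneda.mapIso (specGalIso f Ω σ).op)
  map_one' := by
    ext Y y
    change specGal f Ω 1 ≫ y = y
    rw [specGal_one, Category.id_comp]
  map_mul' σ τ := by
    ext Y y
    change specGal f Ω (σ * τ) ≫ y = specGal f Ω σ ≫ specGal f Ω τ ≫ y
    rw [specGal_mul, Category.assoc]

/-- A check of the defining formula of `galToPi1`. -/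
lemma galToPi1_hom_app (σ : Gal(Ω/k)) (Y : FiniteEtaleOver X)
    (y : Over.mk (geometricPoint f Ω) ⟶ (MorphismProperty.Over.forget _ _ X).obj Y) :
    (galToPi1 f Ω σ).hom.app Y y = specGal f Ω σ ≫ y :=
  rfl

end GaloisToPi1

/-! ### Restriction of Galois groups along an embedding of algebraic closures -/

section Restriction

variable {k k' Ω Ω' : Type*} [Field k] [Field k'] [Field Ω] [Field Ω']
  [Algebra k Ω] [Algebra k' Ω'] [Normal k Ω]

/-- For a commutative square of fields with `i : k → k'` and `ω : Ω → Ω'`, where `Ω/k` is normal,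
the homomorphism `Gal(Ω'/k') → Gal(Ω/k)` given by restriction along `ω`. -/
def galRestrict (i : k →+* k') (ω : Ω →+* Ω')
    (h : ω.comp (algebraMap k Ω) = (algebraMap k' Ω').comp i) :
    Gal(Ω'/k') →* Gal(Ω/k) :=
  letI : Algebra k k' := i.toAlgebra
  letI : Algebra k Ω' := ((algebraMap k' Ω').comp i).toAlgebra
  letI : Algebra Ω Ω' := ω.toAlgebra
  haveI : IsScalarTower k k' Ω' := .of_algebraMap_eq' rfl
  haveI : IsScalarTower k Ω Ω' := .of_algebraMap_eq' h.symm
  (AlgEquiv.restrictNormalHom Ω).comp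
    (MonoidHom.mk' (fun σ : Gal(Ω'/k') ↦ σ.restrictScalars k) fun _ _ ↦ rfl)

/-- `galRestrict` is characterized by `ω ∘ (σ restricted) = σ ∘ ω`. -/
lemma galRestrict_apply (i : k →+* k') (ω : Ω →+* Ω')
    (h : ω.comp (algebraMap k Ω) = (algebraMap k' Ω').comp i) (σ : Gal(Ω'/k')) (a : Ω) :
    ω (galRestrict i ω h σ a) = σ (ω a) := by
  let : Algebra k k' := i.toAlgebra
  let : Algebra k Ω' := ((algebraMap k' Ω').comp i).toAlgebra
  let : Algebra Ω Ω' := ω.toAlgebra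
  have : IsScalarTower k k' Ω' := .of_algebraMap_eq' rfl
  have : IsScalarTower k Ω Ω' := .of_algebraMap_eq' h.symm
  exact (σ.restrictScalars k).restrictNormal_commutes Ω a

end Restriction

/-! ### Completed local rings -/

/-- The completed local ring of `X` at `x`: the completion of the stalk with respect to its
maximal ideal. -/
abbrev CompletedStalk (X : Scheme.{u}) (x : X) : Type u :=
  AdicCompletion (IsLocalRing.maximalIdeal (X.presheaf.stalk x)) (X.presheaf.stalk x)

/-- The closed points of `X`. -/
abbrev ClosedPoint (X : Scheme.{u}) : Type u := {x : X // IsClosed ({x} : Set X)}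

/-- The completed local rings of `X` at all closed points are normal domains. -/
class HasNormalCompletions (X : Scheme.{u}) : Prop where
  isDomain (x : ClosedPoint X) : IsDomain (CompletedStalk X x.1)
  isIntegrallyClosed (x : ClosedPoint X) : IsIntegrallyClosed (CompletedStalk X x.1)

instance (X : Scheme.{u}) [HasNormalCompletions X] (x : ClosedPoint X) :
    IsDomain (CompletedStalk X x.1) := HasNormalCompletions.isDomain x

instance (X : Scheme.{u}) [HasNormalCompletions X] (x : ClosedPoint X) :
    IsIntegrallyClosed (CompletedStalk X x.1) := HasNormalCompletions.isIntegrallyClosed x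

/-- The fraction field `K_x` of the completed local ring. -/
abbrev CompletedField (X : Scheme.{u}) (x : X) : Type u := FractionRing (CompletedStalk X x)

/-- The morphism `Spec K_x ⟶ Spec Ô_{X,x}`. -/
abbrev specCompletedField (X : Scheme.{u}) (x : X) :
    Spec (.of (CompletedField X x)) ⟶ Spec (.of (CompletedStalk X x)) :=
  Spec.map (CommRingCat.ofHom (algebraMap (CompletedStalk X x) (CompletedField X x)))

section FunctionField

lemma stalk_to_completedField_injective (X : Scheme.{u}) [IsLocallyNoetherian X] (x : X) :
    Function.Injective ((algebraMap (CompletedStalk X x) (CompletedField X x)).comp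
      (algebraMap (X.presheaf.stalk x) (CompletedStalk X x))) := by
  refine (IsFractionRing.injective (CompletedStalk X x) (CompletedField X x)).comp ?_
  exact AdicCompletion.of_injective (IsLocalRing.maximalIdeal (X.presheaf.stalk x)) _

variable (X : Scheme.{u}) [IsIntegral X] [IsLocallyNoetherian X]

/-- The embedding `K → K_x` of the function field of `X` into the fraction field of the completed
local ring at `x`, induced by `𝒪_{X,x} → Ô_{X,x}`. -/
def functionFieldToCompletedField (x : X) [IsDomain (CompletedStalk X x)] :
    X.functionField →+* CompletedField X x :=
  IsFractionRing.lift (A := X.presheaf.stalk x) (stalk_to_completedField_injective X x)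

/-- The morphism `Spec K ⟶ X` onto the generic point. -/
abbrev specFunctionField : Spec (.of X.functionField) ⟶ X :=
  X.fromSpecStalk (genericPoint X)

/-- The normalization of `X` in an extension `L` of its function field, i.e. the relative
normalization of `X` in `Spec L ⟶ Spec K ⟶ X`. -/
def normalizationIn (L : Type u) [Field L] [Algebra X.functionField L] : Scheme.{u} :=
  (Spec.map (CommRingCat.ofHom (algebraMap X.functionField L)) ≫ specFunctionField X).normalization

end FunctionField

end

end LocalKernels

/-! Let N be the abstract normal subgroup generated by the images of the local kernels, so that H is
its closure. Pulling finite étale covers of X back to the spectrum of the completed local ring at x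
shows that each local kernel restricts into ker φ (`galRestrict_mem_ker`). Since ker φ is normal and
closed (`isClosed_ker_galToPi1`), H ⊆ ker φ.

For the converse, Galois theory (`mem_topologicalClosure_of_forall`) reduces the claim to this:
every σ in ker φ fixes every separable c fixed by N. Put L = K(c). If the normalization of X in L is
étale over X, it is a finite étale cover, the inclusion of L in the algebraic closure is a point of
its fibre, and so σ fixes L (`apply_eq_of_mem_ker`). What remains is that N fixing L forces this
étaleness.

It is tested over closed points x, after the faithfully flat passage from R = 𝒪_{X,x} to its
completion R̂. Let S be the semilocal ring of the normalization over x. Then R̂ ⊗ S is the product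
of the completions of S at its maximal ideals (`tensorToCompletion_injective`,
`tensorToCompletion_surjective`). These are normal domains by hypothesis, so R̂ ⊗ S is integrally
closed in its generic fibre K_x ⊗ L (`exists_one_tmul_of_isIntegral`). Every K-embedding of L into
the algebraic closure of K_x is conjugate to the one given by ω_x, and N is normal, so ker φ_x fixes
its image, which therefore lies in the maximal unramified extension (`isUnramifiedSet_of_fixed`).
Hence some finite étale domain S' over R̂ splits the generic fibre. Integral closure commutes with
smooth base change, so R̂ ⊗ S becomes a finite power of S' over S', and étaleness descends to R̂ and
then to R (`etale_of_isUnramifiedSet`, `etale_of_completion`). -/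

namespace LocalKernels

noncomputable section

open TensorProduct IsLocalRing

/-! ### Completion of a finite algebra over a local ring -/

section CompletionMap

variable {R T : Type*} [CommRing R] [CommRing T] [Algebra R T] {I : Ideal R} {J : Ideal T}

/-- The map `R̂ → R ⧸ I ^ n → T ⧸ J ^ n` for an algebra `T` over `R` with `I T ⊆ J`. -/
def evalQuotientMap (h : I ≤ J.comap (algebraMap R T)) (n : ℕ) :
    AdicCompletion I R →ₐ[R] T ⧸ J ^ n :=
  (Ideal.quotientMapₐ (J ^ n) (Algebra.ofId R T)
    ((Ideal.pow_right_mono h n).trans (Ideal.le_comap_pow _ n))).comp (AdicCompletion.evalₐ I n)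

lemma factor_comp_evalQuotientMap (h : I ≤ J.comap (algebraMap R T)) {m n : ℕ} (hle : m ≤ n) :
    (Ideal.Quotient.factorₐ R (Ideal.pow_le_pow_right hle)).comp (evalQuotientMap h n) =
      evalQuotientMap h m := by
  ext x
  obtain ⟨x, rfl⟩ := AdicCompletion.mk_surjective I R x
  simp only [evalQuotientMap, AlgHom.comp_apply, AdicCompletion.evalₐ_mk, Ideal.quotient_map_mkₐ,
    Ideal.Quotient.mkₐ_eq_mk]
  have h1 := AdicCompletion.Ideal.mk_eq_mk I hle x
  rw [Ideal.Quotient.eq] at h1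
  change Ideal.Quotient.mk (J ^ m) _ = Ideal.Quotient.mk (J ^ m) _
  rw [Ideal.Quotient.eq, ← map_sub]
  exact (Ideal.pow_right_mono h m).trans (Ideal.le_comap_pow _ m) h1

/-- The map on adic completions induced by an algebra `T` over `R` with `I T ⊆ J`. -/
def completionMap (h : I ≤ J.comap (algebraMap R T)) :
    AdicCompletion I R →ₐ[R] AdicCompletion J T :=
  AdicCompletion.liftAlgHom J (evalQuotientMap h) (factor_comp_evalQuotientMap h)

lemma evalₐ_completionMap (h : I ≤ J.comap (algebraMap R T)) (n : ℕ) (x : AdicCompletion I R)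
    (r : R) (hr : AdicCompletion.evalₐ I n x = Ideal.Quotient.mk _ r) :
    AdicCompletion.evalₐ J n (completionMap h x) = Ideal.Quotient.mk _ (algebraMap R T r) := by
  refine (AdicCompletion.evalₐ_liftAlgHom J _ (factor_comp_evalQuotientMap h) n x).trans ?_
  rw [evalQuotientMap, AlgHom.comp_apply, hr]
  rfl

end CompletionMap

/-! ### Maximal ideals and adic topologies of a finite algebra over a local ring. -/

section Semilocal

variable (R S : Type*) [CommRing R] [IsLocalRing R] [CommRing S] [Algebra R S]

lemma map_maximalIdeal_le [Algebra.IsIntegral R S] (q : MaximalSpectrum S) :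
    (maximalIdeal R).map (algebraMap R S) ≤ q.asIdeal := by
  rw [Ideal.map_le_iff_le_comap, ← eq_maximalIdeal (I := q.asIdeal.comap (algebraMap R S))]
  have := q.isMaximal
  exact Ideal.isMaximal_comap_of_isIntegral_of_isMaximal _

lemma finite_maximalSpectrum [Module.Finite R S] : Finite (MaximalSpectrum S) := by
  have := (Algebra.QuasiFinite.finite_primesOver (S := S) (maximalIdeal R)).to_subtype
  refine Finite.of_injective
    (β := (maximalIdeal R).primesOver S) (fun q ↦ ⟨q.asIdeal, q.isMaximal.isPrime, ⟨?_⟩⟩) ?_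
  · have := q.isMaximal
    exact (eq_maximalIdeal (Ideal.isMaximal_comap_of_isIntegral_of_isMaximal q.asIdeal)).symm
  · intro q q' h
    exact MaximalSpectrum.ext (congrArg Subtype.val h)

/-- By integrality every prime containing the extension of the maximal ideal of `R` is maximal, so
the intersection of the maximal ideals lies in the radical of that extension. Together with
`map_maximalIdeal_le` this says that the two ideals define the same topology on `S`. -/
lemma exists_iInf_maximal_pow_le [IsNoetherianRing R] [Module.Finite R S] :
    ∃ k : ℕ, (⨅ q : MaximalSpectrum S, q.asIdeal) ^ k ≤
      (maximalIdeal R).map (algebraMap R S) := by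
  have : IsNoetherianRing S := IsNoetherianRing.of_finite R S
  refine Ideal.exists_pow_le_of_le_radical_of_fg ?_ (IsNoetherian.noetherian _)
  rw [Ideal.radical_eq_sInf]
  refine le_sInf fun p ⟨hp, hpp⟩ ↦ ?_
  have : p.IsMaximal := by
    refine Ideal.isMaximal_of_isIntegral_of_isMaximal_comap (R := R) p ?_
    have hle : maximalIdeal R ≤ p.comap (algebraMap R S) := Ideal.map_le_iff_le_comap.mp hp
    rw [← (maximalIdeal.isMaximal R).eq_of_le (Ideal.IsPrime.ne_top inferInstance) hle]
    infer_instance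
  exact iInf_le (fun q : MaximalSpectrum S ↦ q.asIdeal) ⟨p, this⟩

variable {S} in
-- For pairwise coprime ideals intersections are products, and products commute with powers.
lemma mem_iInf_pow_of_forall_mem_pow [Finite (MaximalSpectrum S)] {n : ℕ} {s : S}
    (hs : ∀ q : MaximalSpectrum S, s ∈ q.asIdeal ^ n) :
    s ∈ (⨅ q : MaximalSpectrum S, q.asIdeal) ^ n := by
  have : Fintype (MaximalSpectrum S) := Fintype.ofFinite _
  have key : ∀ n : ℕ, ∏ q : MaximalSpectrum S, q.asIdeal ^ n =
      ⨅ q : MaximalSpectrum S, q.asIdeal ^ n := fun n ↦ by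
    rw [Ideal.prod_eq_iInf_of_pairwise_isCoprime fun I _ _ _ ↦ .pow ∘ I.isCoprime_of_ne]
    simp
  have h1 := key 1
  simp only [pow_one] at h1
  rw [← h1, ← Finset.prod_pow, key]
  simpa [Ideal.mem_iInf] using hs

end Semilocal

lemma maximalIdeal_le_comap {R S : Type*} [CommRing R] [IsLocalRing R] [CommRing S] [Algebra R S]
    [Algebra.IsIntegral R S] (q : MaximalSpectrum S) (T : Type*) [CommRing T] [IsLocalRing T]
    [Algebra S T] [Algebra R T] [IsScalarTower R S T] [IsLocalization.AtPrime T q.asIdeal] :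
    maximalIdeal R ≤ (maximalIdeal T).comap (algebraMap R T) := by
  intro r hr
  rw [Ideal.mem_comap, IsScalarTower.algebraMap_apply R S T,
    IsLocalization.AtPrime.to_map_mem_maximal_iff T q.asIdeal]
  exact map_maximalIdeal_le R S q (Ideal.mem_map_of_mem _ hr)

/-! ### The completion of a finite algebra as a product of completed local rings. -/

section Decomposition

variable {R S : Type u} [CommRing R] [IsLocalRing R]
  [CommRing S] [Algebra R S] [Module.Finite R S]
  (T : MaximalSpectrum S → Type u) [∀ q, CommRing (T q)] [∀ q, IsLocalRing (T q)]
  [∀ q, Algebra S (T q)] [∀ q, Algebra R (T q)] [∀ q, IsScalarTower R S (T q)]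
  [∀ q, IsLocalization.AtPrime (T q) q.asIdeal]

/-- The map from the completion `R̂ ⊗ S` of a finite algebra to the completion of a localization
at a maximal ideal. -/
def tensorToCompletion (q : MaximalSpectrum S) :
    AdicCompletion (maximalIdeal R) R ⊗[R] S →ₐ[R] AdicCompletion (maximalIdeal (T q)) (T q) :=
  Algebra.TensorProduct.lift (completionMap (maximalIdeal_le_comap q (T q)))
    (IsScalarTower.toAlgHom R S _) (fun _ _ ↦ .all _ _)

lemma tensorToCompletion_tmul (q : MaximalSpectrum S) (a : AdicCompletion (maximalIdeal R) R)
    (s : S) : tensorToCompletion (R := R) T q (a ⊗ₜ s) =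
      completionMap (maximalIdeal_le_comap q (T q)) a * algebraMap S _ s := rfl

/-- The same `s` represents `z` at level `n` in the completion of the module `S` and in every local
completion, so statements about the product decomposition become congruences in `S`. -/
lemma exists_approx (z : AdicCompletion (maximalIdeal R) R ⊗[R] S) (n : ℕ) :
    ∃ s : S, (AdicCompletion.ofTensorProduct (maximalIdeal R) S z).val n =
        Submodule.Quotient.mk s ∧
      ∀ q, AdicCompletion.evalₐ _ n (tensorToCompletion (R := R) T q z) =
        Ideal.Quotient.mk _ (algebraMap S (T q) s) := by
  induction z with
  | zero => exact ⟨0, by simp, by simp⟩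
  | add x y hx hy =>
    obtain ⟨s, hs, hs'⟩ := hx
    obtain ⟨t, ht, ht'⟩ := hy
    refine ⟨s + t, ?_, fun q ↦ ?_⟩
    · rw [map_add, AdicCompletion.val_add_apply, hs, ht]; rfl
    · simp [hs', ht']
  | tmul a s =>
    obtain ⟨r, hr⟩ := Ideal.Quotient.mk_surjective (AdicCompletion.evalₐ (maximalIdeal R) n a)
    refine ⟨r • s, ?_, fun q ↦ ?_⟩
    · rw [AdicCompletion.ofTensorProduct_tmul, AdicCompletion.smul_eval,
        AdicCompletion.val_smul_eq_evalₐ_smul, ← hr]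
      rfl
    · rw [tensorToCompletion_tmul, map_mul, evalₐ_completionMap _ n a r hr.symm, Algebra.smul_def,
        map_mul, map_mul, ← IsScalarTower.algebraMap_apply]
      congr 1

variable [IsNoetherianRing R]

lemma tensorToCompletion_injective :
    Function.Injective (AlgHom.pi (tensorToCompletion (R := R) T)) := by
  have := finite_maximalSpectrum R S
  obtain ⟨k, hk⟩ := exists_iInf_maximal_pow_le R S
  rw [injective_iff_map_eq_zero]
  intro z hz
  apply (AdicCompletion.ofTensorProduct_bijective_of_finite_of_isNoetherian
    (maximalIdeal R) S).injective
  rw [map_zero]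
  ext n
  -- The `k`-th power of the intersection of the maximal ideals lies in the extended maximal ideal,
  -- so level `(k + 1) * n` controls level `n`. Taking `k + 1` keeps this level at least `n` even
  -- when `k = 0`.
  obtain ⟨s, hs, hs'⟩ := exists_approx T z ((k + 1) * n)
  have hmem : s ∈ (⨅ q : MaximalSpectrum S, q.asIdeal) ^ ((k + 1) * n) := by
    refine mem_iInf_pow_of_forall_mem_pow fun q ↦ ?_
    have := q.isMaximal
    rw [← IsLocalization.AtPrime.under_maximalIdeal_pow q.asIdeal (T q), Ideal.mem_comap,
      ← Ideal.Quotient.eq_zero_iff_mem, ← hs', show tensorToCompletion (R := R) T q z = 0 from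
        congrFun hz q, map_zero]
  have hmem' : s ∈ (maximalIdeal R ^ n • ⊤ : Submodule R S) := by
    rw [Ideal.smul_top_eq_map, Submodule.restrictScalars_mem, Ideal.map_pow]
    rw [pow_mul] at hmem
    exact Ideal.pow_right_mono ((Ideal.pow_le_pow_right (Nat.le_succ k)).trans hk) n hmem
  have h := AdicCompletion.transitionMap_comp_eval_apply (maximalIdeal R) S
    (show n ≤ (k + 1) * n by nlinarith) (AdicCompletion.ofTensorProduct (maximalIdeal R) S z)
  rw [hs] at h
  rw [← h, AdicCompletion.val_zero]
  exact (Submodule.Quotient.mk_eq_zero _).mpr hmem'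

/-- At each level the Chinese remainder theorem gives an element of `S` approximating all components
at once. Along the levels `(k + 1) * n` these elements form a Cauchy sequence for the maximal ideal
of `R`, and its limit is the preimage. -/
lemma tensorToCompletion_surjective :
    Function.Surjective (AlgHom.pi (tensorToCompletion (R := R) T)) := by
  have := finite_maximalSpectrum R S
  obtain ⟨k, hk⟩ := exists_iInf_maximal_pow_le R S
  intro d
  have hlift (n : ℕ) : ∃ s : S, ∀ q, AdicCompletion.evalₐ _ n (d q) =
      Ideal.Quotient.mk _ (algebraMap S (T q) s) := by
    have h1 (q : MaximalSpectrum S) : ∃ s : S, AdicCompletion.evalₐ _ n (d q) =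
        Ideal.Quotient.mk _ (algebraMap S (T q) s) := by
      have := q.isMaximal
      obtain ⟨y, hy⟩ := (IsLocalization.AtPrime.equivQuotMaximalIdealPow q.asIdeal (T q) n).surjective
        (AdicCompletion.evalₐ _ n (d q))
      obtain ⟨s, rfl⟩ := Ideal.Quotient.mk_surjective y
      exact ⟨s, by rw [← hy, IsLocalization.AtPrime.equivQuotMaximalIdealPow_apply_mk]⟩
    choose s hs using h1
    obtain ⟨r, hr⟩ := Ideal.exists_forall_sub_mem_ideal
      (I := fun q : MaximalSpectrum S ↦ q.asIdeal ^ n)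
      (fun I _ h ↦ (I.isCoprime_of_ne h).pow) s
    refine ⟨r, fun q ↦ ?_⟩
    have := q.isMaximal
    rw [hs q, eq_comm, Ideal.Quotient.eq, ← map_sub, ← Ideal.mem_comap,
      ← Ideal.under_def, IsLocalization.AtPrime.under_maximalIdeal_pow q.asIdeal (T q)]
    exact hr q
  choose r hr using hlift
  have hr' {m n : ℕ} (hmn : m ≤ n) (q) : AdicCompletion.evalₐ _ m (d q) =
      Ideal.Quotient.mk _ (algebraMap S (T q) (r n)) := by
    obtain ⟨x, hx⟩ := AdicCompletion.mk_surjective _ _ (d q)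
    have h := hr n q
    rw [← hx, AdicCompletion.evalₐ_mk] at h ⊢
    rw [← AdicCompletion.Ideal.mk_eq_mk _ hmn]
    rw [Ideal.Quotient.eq] at h ⊢
    exact Ideal.pow_le_pow_right hmn h
  have hc (n : ℕ) : r ((k + 1) * n) ≡ r ((k + 1) * (n + 1))
      [SMOD (maximalIdeal R ^ n • ⊤ : Submodule R S)] := by
    rw [SModEq.sub_mem, Ideal.smul_top_eq_map, Submodule.restrictScalars_mem, Ideal.map_pow]
    refine Ideal.pow_right_mono ((Ideal.pow_le_pow_right (Nat.le_succ k)).trans hk) n ?_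
    rw [← pow_mul]
    refine mem_iInf_pow_of_forall_mem_pow fun q ↦ ?_
    have := q.isMaximal
    rw [← IsLocalization.AtPrime.under_maximalIdeal_pow q.asIdeal (T q), Ideal.mem_comap, map_sub,
      ← Ideal.Quotient.eq, ← hr, ← hr' (by nlinarith)]
  obtain ⟨z, hz⟩ := (AdicCompletion.ofTensorProduct_bijective_of_finite_of_isNoetherian
    (maximalIdeal R) S).surjective (AdicCompletion.mk _ _ (.mk _ _ (fun n ↦ r ((k + 1) * n)) hc))
  refine ⟨z, funext fun q ↦ AdicCompletion.ext_evalₐ fun n ↦ ?_⟩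
  obtain ⟨s, hs, hs'⟩ := exists_approx T z n
  rw [hz] at hs
  change Submodule.Quotient.mk (r ((k + 1) * n)) = _ at hs
  rw [Submodule.Quotient.eq, Ideal.smul_top_eq_map, Submodule.restrictScalars_mem,
    Ideal.map_pow] at hs
  change AdicCompletion.evalₐ _ n (tensorToCompletion (R := R) T q z) = _
  rw [hs', hr' (n := (k + 1) * n) (by nlinarith), eq_comm, Ideal.Quotient.eq, ← map_sub,
    ← Ideal.mem_comap]
  have := q.isMaximal
  rw [← Ideal.under_def, IsLocalization.AtPrime.under_maximalIdeal_pow q.asIdeal (T q)]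
  exact Ideal.pow_right_mono (map_maximalIdeal_le R S q) n hs

end Decomposition

end

end LocalKernels

namespace LocalKernels

noncomputable section

open TensorProduct IsLocalRing

/-! ### Normality of the completion of a finite algebra -/

section TorsionFree

variable {R A S L : Type*} [CommRing R] [CommRing A] [IsDomain A] [Algebra R A]
  [Module.Flat R A] [CommRing S] [Algebra R S] [AddCommGroup L] [Module R L] [Module.Flat R L]

/-- `S` is not assumed flat; torsion-freeness is inherited from `A ⊗ L`. Flatness of `A` embeds `A ⊗
S` there, and flatness of `L` keeps multiplication by `a` injective. In the application `L` is the
extension field. -/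
lemma eq_zero_of_tmul_one_mul_eq_zero (ι : S →ₗ[R] L) (hι : Function.Injective ι) {a : A} (ha : a ≠ 0)
    {z : A ⊗[R] S} (hz : (a ⊗ₜ 1) * z = 0) : z = 0 := by
  have h1 : Function.Injective (ι.lTensor A) := Module.Flat.lTensor_preserves_injective_linearMap _ hι
  have h2 : Function.Injective ((LinearMap.mulLeft R a).rTensor L) :=
    Module.Flat.rTensor_preserves_injective_linearMap _ (mul_right_injective₀ ha)
  replace hz : a • z = 0 := by rw [Algebra.smul_def]; exact hz
  have h3 : ∀ w : A ⊗[R] L, (LinearMap.mulLeft R a).rTensor L w = a • w := fun w ↦ by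
    induction w with
    | zero => simp
    | add x y hx hy => rw [map_add, hx, hy, smul_add]
    | tmul b s => simp [smul_tmul']
  have h4 : ∀ w : A ⊗[R] S, ι.lTensor A (a • w) = a • ι.lTensor A w := fun w ↦ by
    induction w with
    | zero => simp
    | add x y hx hy => rw [smul_add, map_add, hx, hy, map_add, smul_add]
    | tmul b s => simp [smul_tmul']
  apply h1
  apply h2
  rw [h3, ← h4, hz, map_zero, map_zero]

end TorsionFree

section FractionTensor

variable {A M : Type*} (k : Type*) [CommRing A] [IsDomain A] [Field k] [Algebra A k]
  [IsFractionRing A k] [CommRing M] [Algebra A M]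

lemma exists_smul_eq_one_tmul (c : k ⊗[A] M) :
    ∃ a : A, a ≠ 0 ∧ ∃ b : M, a • c = 1 ⊗ₜ b := by
  induction c with
  | zero => exact ⟨1, one_ne_zero, 0, by simp⟩
  | add x y hx hy =>
    obtain ⟨a, ha, b, hb⟩ := hx
    obtain ⟨a', ha', b', hb'⟩ := hy
    refine ⟨a * a', mul_ne_zero ha ha', a' • b + a • b', ?_⟩
    rw [smul_add, mul_comm, mul_smul, hb, mul_comm, mul_smul, hb', tmul_add, tmul_smul, tmul_smul]
  | tmul x m =>
    obtain ⟨⟨n, d⟩, h⟩ := IsLocalization.surj (nonZeroDivisors A) x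
    refine ⟨d, nonZeroDivisors.ne_zero d.2, n • m, ?_⟩
    rw [smul_tmul', Algebra.smul_def, mul_comm, h, tmul_smul, smul_tmul', Algebra.smul_def, mul_one]

lemma eq_one_tmul_of_smul_eq {A M k : Type*} [CommRing A] [Field k] [Algebra A k]
    [IsFractionRing A k] [CommRing M] [Algebra A M] {a : A} (ha : a ≠ 0) {c : k ⊗[A] M} {z : M}
    (h : a • c = 1 ⊗ₜ (a • z)) : c = 1 ⊗ₜ z := by
  have ha' : algebraMap A k a ≠ 0 := by rwa [Ne, FaithfulSMul.algebraMap_eq_zero_iff]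
  have h' : algebraMap A k a • c = algebraMap A k a • (1 ⊗ₜ z) := by
    rw [algebraMap_smul, algebraMap_smul, h, tmul_smul]
  rw [← inv_smul_smul₀ ha' c, h', inv_smul_smul₀ ha']

/-- `k ⊗ M` is the localization of `M` at the nonzero elements of `A`, so only torsion could die in
it. -/
lemma one_tmul_injective (h : ∀ (a : A) (m : M), a ≠ 0 → a • m = 0 → m = 0) :
    Function.Injective (fun m : M ↦ (1 : k) ⊗ₜ[A] m) := by
  have : Module.IsTorsionFree A M := by
    refine ⟨fun a ha m m' hm ↦ ?_⟩
    rw [← sub_eq_zero]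
    refine h a _ ha.ne_zero ?_
    rw [smul_sub, sub_eq_zero]
    exact hm
  have := (isLocalizedModule_iff_isBaseChange (nonZeroDivisors A) k
    (TensorProduct.mk A k M 1)).mpr (TensorProduct.isBaseChange A M k)
  intro m m' hm
  obtain ⟨c, hc⟩ := (IsLocalizedModule.eq_iff_exists (nonZeroDivisors A)
    (TensorProduct.mk A k M 1)).mp hm
  rw [← sub_eq_zero]
  refine h c _ (nonZeroDivisors.ne_zero c.2) ?_
  rw [smul_sub, sub_eq_zero]
  exact hc

end FractionTensor

section Normality

variable {R S : Type u} [CommRing R] [IsLocalRing R] [IsNoetherianRing R]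
  [CommRing S] [Algebra R S] [Module.Finite R S]
  (T : MaximalSpectrum S → Type u) [∀ q, CommRing (T q)] [∀ q, IsLocalRing (T q)]
  [∀ q, Algebra S (T q)] [∀ q, Algebra R (T q)] [∀ q, IsScalarTower R S (T q)]
  [∀ q, IsLocalization.AtPrime (T q) q.asIdeal]
  [∀ q, IsDomain (AdicCompletion (maximalIdeal (T q)) (T q))]
  [IsDomain (AdicCompletion (maximalIdeal R) R)]

/-- If `a` dies in the factor at `q`, it annihilates the idempotent `e` cutting out that factor. By
torsion-freeness a nonzero `a` would give `e = 0`, although the factor is a domain and hence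
nonzero. -/
lemma completionMap_injective {L : Type*} [AddCommGroup L] [Module R L] [Module.Flat R L]
    (ι : S →ₗ[R] L) (hι : Function.Injective ι) (q : MaximalSpectrum S) :
    Function.Injective (completionMap (maximalIdeal_le_comap (R := R) q (T q))) := by
  classical
  rw [injective_iff_map_eq_zero]
  intro a ha
  by_contra ha0
  obtain ⟨e, he⟩ := tensorToCompletion_surjective (R := R) T (Pi.single q 1)
  have he0 : e = 0 := by
    refine eq_zero_of_tmul_one_mul_eq_zero ι hι ha0 (tensorToCompletion_injective T ?_)
    rw [map_zero]
    funext q'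
    have h2 : tensorToCompletion (R := R) T q' e = (Pi.single q 1 :
        ∀ q', AdicCompletion (maximalIdeal (T q')) (T q')) q' := congrFun he q'
    change tensorToCompletion (R := R) T q' ((a ⊗ₜ 1) * e) = 0
    rw [map_mul, h2, tensorToCompletion_tmul]
    by_cases hq : q' = q
    · subst hq
      rw [ha]; simp
    · rw [Pi.single_eq_of_ne hq, mul_zero]
  have := congrFun he q
  rw [he0, map_zero, Pi.single_eq_same] at this
  exact zero_ne_one this

/-- Write `c` as `b / a`. In the fraction field of each factor the quotient is integral, so it lies
in the factor by normality. These quotients glue because `R̂ ⊗ S` is the full product. -/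
lemma exists_one_tmul_of_isIntegral
    [∀ q, IsIntegrallyClosed (AdicCompletion (maximalIdeal (T q)) (T q))]
    {L : Type*} [AddCommGroup L] [Module R L] [Module.Flat R L]
    (ι : S →ₗ[R] L) (hι : Function.Injective ι)
    (k : Type*) [Field k] [Algebra (AdicCompletion (maximalIdeal R) R) k]
    [IsFractionRing (AdicCompletion (maximalIdeal R) R) k]
    (c : k ⊗[AdicCompletion (maximalIdeal R) R] (AdicCompletion (maximalIdeal R) R ⊗[R] S))
    (hc : IsIntegral (AdicCompletion (maximalIdeal R) R) c) :
    ∃ z : AdicCompletion (maximalIdeal R) R ⊗[R] S, c = 1 ⊗ₜ z := by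
  obtain ⟨a, ha, b, hb⟩ := exists_smul_eq_one_tmul k c
  have key (q : MaximalSpectrum S) : ∃ d : AdicCompletion (maximalIdeal (T q)) (T q),
      tensorToCompletion (R := R) T q b = completionMap (maximalIdeal_le_comap q (T q)) a * d := by
    set A := AdicCompletion (maximalIdeal R) R
    set D := AdicCompletion (maximalIdeal (T q)) (T q)
    let F := FractionRing D
    let : Algebra A D := (completionMap (maximalIdeal_le_comap q (T q))).toRingHom.toAlgebra
    have hinj : Function.Injective (algebraMap A F) :=
      by
      rw [IsScalarTower.algebraMap_eq A D F]
      exact (IsFractionRing.injective D F).comp (completionMap_injective T ι hι q)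
    let φ : A ⊗[R] S →ₐ[A] D :=
      { (tensorToCompletion (R := R) T q).toRingHom with
        commutes' r := by
          change tensorToCompletion (R := R) T q (r ⊗ₜ 1) = _
          rw [tensorToCompletion_tmul, map_one, mul_one]; rfl }
    -- The generic fibre maps to the fraction field of the factor because the completed map is
    -- injective, so nonzero denominators from `A` stay invertible.
    let ψ : k ⊗[A] (A ⊗[R] S) →ₐ[A] F :=
      Algebra.TensorProduct.lift (IsFractionRing.liftAlgHom (g := Algebra.ofId A F) hinj)
        ((IsScalarTower.toAlgHom A D F).comp φ) (fun _ _ ↦ .all _ _)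
    obtain ⟨d, hd⟩ := IsIntegrallyClosed.isIntegral_iff.mp ((hc.map ψ).tower_top (A := D))
    refine ⟨d, IsFractionRing.injective D F ?_⟩
    have h1 := congrArg ψ hb
    rw [map_smul, ← hd] at h1
    have h2 : ψ (1 ⊗ₜ b) = algebraMap D F (tensorToCompletion (R := R) T q b) := by
      simp only [ψ, Algebra.TensorProduct.lift_tmul, map_one, one_mul]; rfl
    rw [h2, Algebra.smul_def] at h1
    rw [← h1, map_mul]; rfl
  choose d hd using key
  obtain ⟨z, hz⟩ := tensorToCompletion_surjective (R := R) T d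
  have hab : (a ⊗ₜ[R] 1) * z = b := by
    refine tensorToCompletion_injective T (funext fun q ↦ ?_)
    change tensorToCompletion (R := R) T q ((a ⊗ₜ[R] 1) * z) = tensorToCompletion (R := R) T q b
    have h2 : tensorToCompletion (R := R) T q z = d q := congrFun hz q
    rw [map_mul, h2, hd, tensorToCompletion_tmul, map_one, mul_one]
  refine ⟨z, ?_⟩
  refine eq_one_tmul_of_smul_eq ha ?_
  rw [hb, ← hab]
  congr 1
  exact (Algebra.smul_def a z).symm

end Normality

end

end LocalKernels

namespace LocalKernels

noncomputable section

open TensorProduct IsLocalRing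

/-! ### The maximal unramified extension of a normal domain -/

section NormalBaseChange

variable {A B k : Type*} [CommRing A] [IsIntegrallyClosed A] [CommRing B] [Algebra A B]
  [Algebra.Smooth A B] [Field k] [Algebra A k] [IsFractionRing A k]

/-- A smooth algebra over a normal domain is integrally closed in its generic fibre. -/
lemma exists_tmul_one_of_isIntegral {c : B ⊗[A] k} (hc : _root_.IsIntegral B c) :
    ∃ b : B, c = b ⊗ₜ 1 := by
  obtain ⟨z, hz⟩ := (TensorProduct.toIntegralClosure_bijective_of_smooth
    (R := A) (S := B) (B := k)).surjective ⟨c, hc⟩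
  have hz' : Algebra.TensorProduct.map (.id B B) (integralClosure A k).val z = c :=
    congrArg Subtype.val hz
  rw [← hz']
  clear hz hz'
  induction z with
  | zero => exact ⟨0, by simp⟩
  | add x y hx hy =>
    obtain ⟨b, hb⟩ := hx
    obtain ⟨b', hb'⟩ := hy
    exact ⟨b + b', by rw [map_add, hb, hb', add_tmul]⟩
  | tmul b x =>
    obtain ⟨a, ha⟩ := IsIntegrallyClosed.isIntegral_iff.mp x.2
    refine ⟨a • b, ?_⟩
    rw [Algebra.TensorProduct.map_tmul, smul_tmul, ← Algebra.algebraMap_eq_smul_one]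
    simp [ha]

end NormalBaseChange

section Component

variable {A B Ω : Type u} [CommRing A] [IsIntegrallyClosed A] [CommRing B]
  [Algebra A B] [Module.Finite A B] [Algebra.Etale A B] [Field Ω] [Algebra A Ω]

/-- The kernel of a point of a finite étale algebra over a normal domain is generated by an
idempotent. -/
lemma exists_isIdempotentElem_ker_eq_span (k : Type u) [Field k] [Algebra A k]
    [IsFractionRing A k] [Algebra k Ω] [IsScalarTower A k Ω] (y : B →ₐ[A] Ω) :
    ∃ e : B, IsIdempotentElem e ∧ RingHom.ker y = Ideal.span {e} := by
  let yk : k ⊗[A] B →ₐ[k] Ω := Algebra.TensorProduct.lift (Algebra.ofId k Ω) y (fun _ _ ↦ .all _ _)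
  -- The generic fibre is a finite étale algebra over a field, hence semisimple, and its ideals are
  -- generated by idempotents.
  have : IsArtinianRing (k ⊗[A] B) := .of_finite k _
  have : IsReduced (k ⊗[A] B) := Algebra.FormallyUnramified.isReduced_of_field k _
  have := IsArtinianRing.isSemisimpleRing_of_isReduced (k ⊗[A] B)
  obtain ⟨e, he, hker⟩ := IsSemisimpleRing.ideal_eq_span_idempotent (RingHom.ker yk)
  let σ := Algebra.TensorProduct.comm A k B
  have he' : IsIdempotentElem (σ e) := he.map σ
  -- An idempotent is a root of the monic polynomial `X ^ 2 - X`, so it is integral and already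
  -- comes from `B`.
  obtain ⟨b, hb⟩ : ∃ b : B, σ e = b ⊗ₜ 1 := by
    refine exists_tmul_one_of_isIntegral ⟨Polynomial.X ^ 2 - Polynomial.X, ?_, ?_⟩
    · exact Polynomial.monic_X_pow_sub (Polynomial.degree_X_le.trans_lt (by norm_num))
    · simp [pow_two, he'.eq]
  have hinj : Function.Injective (Algebra.TensorProduct.includeLeft : B →ₐ[B] B ⊗[A] k) :=
    Algebra.TensorProduct.includeLeft_injective (FaithfulSMul.algebraMap_injective A k)
  have heb : e = 1 ⊗ₜ b := by
    rw [← σ.symm_apply_apply e, hb]; rfl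
  have hb2 : IsIdempotentElem b := by
    apply hinj
    rw [hb] at he'
    simpa [IsIdempotentElem] using he'
  refine ⟨b, hb2, le_antisymm (fun x hx ↦ ?_) ?_⟩
  · have h1 : (1 : k) ⊗ₜ[A] x ∈ RingHom.ker yk := by
      rw [RingHom.mem_ker] at hx ⊢
      simp [yk, hx]
    rw [hker, Ideal.mem_span_singleton] at h1
    obtain ⟨c, hc⟩ := h1
    have h2 : (1 : k) ⊗ₜ[A] x * e = 1 ⊗ₜ[A] x := by
      rw [hc, mul_comm e, mul_assoc, he.eq]
    have h3 : x * b = x := by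
      apply hinj
      rw [heb] at h2
      simpa [σ] using congrArg σ h2
    rw [← h3]
    exact Ideal.mul_mem_left _ _ (Ideal.mem_span_singleton_self b)
  · rw [Ideal.span_singleton_le_iff_mem, RingHom.mem_ker]
    have : e ∈ RingHom.ker yk := hker ▸ Ideal.mem_span_singleton_self e
    rw [RingHom.mem_ker, heb] at this
    simpa [yk] using this

/-- Dividing by an idempotent is the same as inverting its complement, so the image of the point is
a localization of `B`, and hence étale over `A`. -/
lemma etale_range (k : Type u) [Field k] [Algebra A k]
    [IsFractionRing A k] [Algebra k Ω] [IsScalarTower A k Ω] (y : B →ₐ[A] Ω) : Algebra.Etale A y.range := by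
  obtain ⟨e, he, hker⟩ := exists_isIdempotentElem_ker_eq_span k y
  let : Algebra B y.range := y.rangeRestrict.toRingHom.toAlgebra
  have : IsScalarTower A B y.range := .of_algebraMap_eq' y.rangeRestrict.comp_algebraMap.symm
  have : IsLocalization.Away (1 - e) y.range := by
    refine IsLocalization.away_of_isIdempotentElem he.one_sub ?_ y.rangeRestrict_surjective
    have : RingHom.ker (algebraMap B y.range) = RingHom.ker y := by
      ext b
      rw [RingHom.mem_ker, RingHom.mem_ker, ← Subtype.coe_inj]
      rfl
    rw [this, hker]; simp
  have : Algebra.Etale B y.range := .of_isLocalizationAway (1 - e)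
  exact .comp A B _

end Component

end

end LocalKernels

namespace LocalKernels

noncomputable section

open TensorProduct IsLocalRing

section UnramifiedField

variable (A k Ω : Type u) [CommRing A] [Field k] [Field Ω] [Algebra A Ω] [Algebra k Ω]

/-- `F` is contained in the `k`-algebra generated by the values at a single point of a finite étale
`A`-algebra. -/
def IsUnramifiedSet (F : Set Ω) : Prop :=
  ∃ (B : Type u) (_ : CommRing B) (_ : Algebra A B) (_ : Module.Finite A B)
    (_ : Algebra.Etale A B) (y : B →ₐ[A] Ω), F ⊆ Algebra.adjoin k (Set.range y)

variable {A k Ω}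

lemma IsUnramifiedSet.mono {F G : Set Ω} (hG : IsUnramifiedSet A k Ω G) (h : F ⊆ G) :
    IsUnramifiedSet A k Ω F := by
  obtain ⟨B, _, _, _, _, y, hy⟩ := hG
  exact ⟨B, _, _, ‹_›, ‹_›, y, h.trans hy⟩

lemma IsUnramifiedSet.adjoin {F : Set Ω} (hF : IsUnramifiedSet A k Ω F) :
    IsUnramifiedSet A k Ω (Algebra.adjoin k F) := by
  obtain ⟨B, _, _, _, _, y, hy⟩ := hF
  exact ⟨B, _, _, ‹_›, ‹_›, y, Algebra.adjoin_le hy⟩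

lemma IsUnramifiedSet.empty : IsUnramifiedSet A k Ω ∅ :=
  ⟨A, _, _, inferInstance, inferInstance, Algebra.ofId A Ω, Set.empty_subset _⟩

/-- The tensor product of the two covers is finite étale and has a point whose values include those
of both. -/
lemma IsUnramifiedSet.union {F G : Set Ω} (hF : IsUnramifiedSet A k Ω F)
    (hG : IsUnramifiedSet A k Ω G) : IsUnramifiedSet A k Ω (F ∪ G) := by
  obtain ⟨B, _, _, _, _, y, hy⟩ := hF
  obtain ⟨B', _, _, _, _, y', hy'⟩ := hG
  refine ⟨B ⊗[A] B', inferInstance, inferInstance, inferInstance, .comp A B _,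
    Algebra.TensorProduct.productMap y y', Set.union_subset
      (hy.trans (Algebra.adjoin_mono ?_)) (hy'.trans (Algebra.adjoin_mono ?_))⟩
  · rintro _ ⟨b, rfl⟩
    exact ⟨b ⊗ₜ 1, by simp⟩
  · rintro _ ⟨b, rfl⟩
    exact ⟨1 ⊗ₜ b, by simp⟩

lemma IsUnramifiedSet.of_finite {F : Set Ω} (hF : F.Finite)
    (h : ∀ x ∈ F, IsUnramifiedSet A k Ω {x}) : IsUnramifiedSet A k Ω F := by
  induction F, hF using Set.Finite.induction_on with
  | empty => exact .empty
  | @insert a s _ _ ih =>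
    rw [Set.insert_eq]
    exact (h a (Set.mem_insert _ _)).union (ih fun x hx ↦ h x (Set.mem_insert_of_mem _ hx))

variable (A k Ω) in
/-- The maximal unramified extension of `k` with respect to `A` inside `Ω`. -/
def unramifiedField [Algebra.IsAlgebraic k Ω] : IntermediateField k Ω :=
  Subalgebra.toIntermediateField
    { carrier := {x | IsUnramifiedSet A k Ω {x}}
      mul_mem' hx hy := (hx.union hy).adjoin.mono <| Set.singleton_subset_iff.mpr <|
        mul_mem (Algebra.subset_adjoin (.inl rfl)) (Algebra.subset_adjoin (.inr rfl))
      add_mem' hx hy := (hx.union hy).adjoin.mono <| Set.singleton_subset_iff.mpr <|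
        add_mem (Algebra.subset_adjoin (.inl rfl)) (Algebra.subset_adjoin (.inr rfl))
      algebraMap_mem' r := IsUnramifiedSet.empty.adjoin.mono <| Set.singleton_subset_iff.mpr <|
        Subalgebra.algebraMap_mem _ r }
    fun x hx ↦ IsUnramifiedSet.mono (IsUnramifiedSet.adjoin hx) <| Set.singleton_subset_iff.mpr <|
      Subalgebra.inv_mem_of_algebraic (Algebra.adjoin k {x})
        (x := ⟨x, Algebra.subset_adjoin rfl⟩) (Algebra.IsAlgebraic.isAlgebraic _)

lemma mem_unramifiedField [Algebra.IsAlgebraic k Ω] {x : Ω} :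
    x ∈ unramifiedField A k Ω ↔ IsUnramifiedSet A k Ω {x} := Iff.rfl

/-- A separable element of a normal extension fixed by all automorphisms over `M` lies in `M`. -/
lemma mem_of_forall_algEquiv_eq {M Ω : Type*} [Field M] [Field Ω] [Algebra M Ω] [Normal M Ω]
    {c : Ω} (hsep : IsSeparable M c) (h : ∀ σ : Gal(Ω/M), σ c = c) :
    c ∈ (algebraMap M Ω).range := by
  have hint : _root_.IsIntegral M c := Normal.isIntegral inferInstance c
  rw [← minpoly.natDegree_eq_one_iff]
  -- Every root of the minimal polynomial is conjugate to `c`, hence equal to `c`; separability then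
  -- forces degree one.
  have hroots : ∀ x ∈ (minpoly M c).rootSet Ω, x = c := fun x hx ↦ by
    obtain ⟨σ, hσ⟩ := minpoly.exists_algEquiv_of_root hint.isAlgebraic
      ((Polynomial.mem_rootSet.mp hx).2)
    rw [← σ.symm_apply_apply x, hσ, h]
  have hcard := Polynomial.card_rootSet_eq_natDegree hsep (Normal.splits inferInstance c)
  rw [← hcard]
  refine le_antisymm (Fintype.card_le_one_iff.mpr fun a b ↦ Subtype.ext ?_) ?_
  · rw [hroots a a.2, hroots b b.2]
  · exact Fintype.card_pos_iff.mpr ⟨⟨c, Polynomial.mem_rootSet.mpr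
      ⟨minpoly.ne_zero hint, minpoly.aeval M c⟩⟩⟩

/-- Automorphisms over `unramifiedField` fix all values of finite étale algebras, hence fix `c`.
Separability is needed because the fixed field of all these automorphisms may be a purely
inseparable extension of `unramifiedField`. -/
lemma isUnramifiedSet_of_forall_fixed [IsAlgClosure k Ω] {c : Ω} (hsep : IsSeparable k c)
    (h : ∀ σ : Gal(Ω/k), (∀ (B : Type u) [CommRing B] [Algebra A B] [Module.Finite A B]
      [Algebra.Etale A B] (y : B →ₐ[A] Ω) (b : B), σ (y b) = y b) → σ c = c) :
    IsUnramifiedSet A k Ω {c} := by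
  have := IsAlgClosure.isAlgebraic (R := k) (K := Ω)
  have := IsAlgClosure.isAlgClosed (R := k) (K := Ω)
  rw [← mem_unramifiedField]
  have : Algebra.IsAlgebraic (unramifiedField A k Ω) Ω := .tower_top (K := k) _
  have : IsAlgClosure (unramifiedField A k Ω) Ω := ⟨inferInstance, inferInstance⟩
  have : Normal (unramifiedField A k Ω) Ω := IsAlgClosure.normal _ _
  have hsep' : IsSeparable (unramifiedField A k Ω) c := hsep.tower_top _
  suffices hσ : ∀ σ : Gal(Ω/unramifiedField A k Ω), σ c = c by
    obtain ⟨m, rfl⟩ := mem_of_forall_algEquiv_eq hsep' hσ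
    exact m.2
  intro σ
  refine h (σ.restrictScalars k) fun B _ _ _ _ y b ↦ ?_
  exact σ.commutes ⟨y b, B, _, _, ‹_›, ‹_›, y,
      Set.singleton_subset_iff.mpr (Algebra.subset_adjoin ⟨b, rfl⟩)⟩

end UnramifiedField

section Splitting

/-- A finite étale algebra all of whose geometric points are defined over `F` splits over `F`. -/
lemma exists_algEquiv_pi_of_forall_mem {k Ω C : Type u} [Field k] [Field Ω] [Algebra k Ω]
    [IsAlgClosed Ω] [Algebra.IsAlgebraic k Ω] [CommRing C] [Algebra k C] [Algebra.Etale k C]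
    (F : IntermediateField k Ω) (h : ∀ (τ : C →ₐ[k] Ω) (c : C), τ c ∈ F) :
    ∃ (J : Type u) (_ : Finite J), Nonempty (F ⊗[k] C ≃ₐ[F] (J → F)) := by
  obtain ⟨J, hJ, K, hK, hA, e, hsep⟩ := (Algebra.Etale.iff_exists_algEquiv_prod F (F ⊗[k] C)).mp
    inferInstance
  refine ⟨J, hJ, ⟨e.trans (AlgEquiv.piCongrRight fun j ↦ ?_)⟩⟩
  have := (hsep j).1
  have hbij : Function.Bijective (algebraMap F (K j)) := by
    refine ⟨(algebraMap F (K j)).injective, fun x ↦ ?_⟩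
    let ε : K j →ₐ[F] Ω := IsAlgClosed.lift
    let p : F ⊗[k] C →ₐ[F] K j := (Pi.evalAlgHom F K j).comp e.toAlgHom
    have hp : Function.Surjective p := fun x ↦ by
      classical
      exact ⟨e.symm (Pi.single j x), by simp [p]⟩
    -- A field factor of `F ⊗ C` is generated over `F` by the image of `C`. Once it is embedded in
    -- `Ω`, that image lies in `F`, so the factor equals `F`.
    have hmem : ∀ z : F ⊗[k] C, ε (p z) ∈ F := fun z ↦ by
      induction z with
      | zero => simp
      | add x y hx hy => rw [map_add, map_add]; exact add_mem hx hy
      | tmul f c =>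
        have h1 : f ⊗ₜ[k] c = f • ((1 : F) ⊗ₜ[k] c) := by rw [smul_tmul', smul_eq_mul, mul_one]
        rw [h1, map_smul, map_smul, Algebra.smul_def]
        exact mul_mem f.2 (h (((ε.comp p).restrictScalars k).comp
          Algebra.TensorProduct.includeRight) c)
    obtain ⟨z, rfl⟩ := hp x
    refine ⟨⟨ε (p z), hmem z⟩, ε.injective ?_⟩
    exact ε.commutes _
  exact (AlgEquiv.ofBijective (Algebra.ofId F (K j)) hbij).symm

end Splitting

end

end LocalKernels

namespace LocalKernels

noncomputable section

open TensorProduct IsLocalRing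

/-! ### Étaleness over a normal domain from unramified geometric points. -/

section EtaleOfPoints

variable {A k Ω : Type u} [CommRing A] [Field k] [Field Ω] [Algebra A Ω] [Algebra k Ω]

/-- There are finitely many points `τ`, and finitely many generators of `C` suffice, so a single
finite étale algebra carries all the values. -/
lemma exists_etale_point_forall_mem_adjoin {C : Type u} [CommRing C] [Algebra k C]
    [Module.Finite k C] (h : ∀ (τ : C →ₐ[k] Ω) (c : C), IsUnramifiedSet A k Ω {τ c}) :
    ∃ (B : Type u) (_ : CommRing B) (_ : Algebra A B) (_ : Module.Finite A B)
      (_ : Algebra.Etale A B) (y : B →ₐ[A] Ω),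
      ∀ (τ : C →ₐ[k] Ω) (c : C), τ c ∈ Algebra.adjoin k (Set.range y) := by
  obtain ⟨s, hs⟩ := Module.Finite.fg_top (R := k) (M := C)
  have hfin : (Set.range fun p : (C →ₐ[k] Ω) × s ↦ p.1 p.2).Finite := by
    have : Finite (C →ₐ[k] Ω) := Finite.of_fintype _
    exact Set.finite_range _
  obtain ⟨B, i1, i2, i3, i4, y, hy⟩ := IsUnramifiedSet.of_finite (A := A) (k := k) hfin
    (by rintro _ ⟨p, rfl⟩; exact h _ _)
  refine ⟨B, i1, i2, i3, i4, y, fun τ c ↦ ?_⟩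
  have hc : c ∈ Submodule.span k (s : Set C) := hs ▸ Submodule.mem_top
  induction hc using Submodule.span_induction with
  | mem x hx => exact hy ⟨(τ, ⟨x, hx⟩), rfl⟩
  | zero => rw [map_zero]; exact zero_mem _
  | add x z _ _ hx hz => rw [map_add]; exact add_mem hx hz
  | smul a x _ hx => rw [map_smul]; exact Subalgebra.smul_mem _ hx a

/-- The intermediate field generated by an `A`-subalgebra. -/
def fieldSpan (k : Type u) [Field k] [Algebra k Ω] [Algebra.IsAlgebraic k Ω]
    (S : Subalgebra A Ω) : IntermediateField k Ω :=
  (Algebra.adjoin k (S : Set Ω)).toIntermediateField fun x hx ↦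
    Subalgebra.inv_mem_of_algebraic _ (x := ⟨x, hx⟩) (Algebra.IsAlgebraic.isAlgebraic _)

variable [IsDomain A] [Algebra A k] [IsFractionRing A k] [IsScalarTower A k Ω]
  [Algebra.IsAlgebraic k Ω] (S : Subalgebra A Ω)

/-- The inclusion of a subalgebra into the field it generates. -/
def toFieldSpan : S →ₐ[A] fieldSpan k S where
  toFun s := ⟨s, Algebra.subset_adjoin s.2⟩
  map_one' := rfl
  map_mul' _ _ := rfl
  map_zero' := rfl
  map_add' _ _ := rfl
  commutes' a := Subtype.ext <| by
    rw [IsScalarTower.algebraMap_apply A k (fieldSpan k S)]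
    exact IsScalarTower.algebraMap_apply A k Ω a

variable (k) in
-- The field generated by `S` is reached by inverting elements of `A` alone. Viewing it as `k ⊗ S`
-- lets smooth base change show that `S` is integrally closed in it.
lemma lift_toFieldSpan_bijective :
    Function.Bijective (Algebra.TensorProduct.lift (Algebra.ofId k (fieldSpan k S))
      (toFieldSpan (k := k) S) (fun _ _ ↦ .all _ _)) := by
  set φ := Algebra.TensorProduct.lift (Algebra.ofId k (fieldSpan k S))
      (toFieldSpan (k := k) S) (fun _ _ ↦ .all _ _)
  constructor
  · rw [injective_iff_map_eq_zero]
    intro z hz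
    obtain ⟨a, ha, s, hs⟩ := exists_smul_eq_one_tmul k z
    have h1 : φ ((1 : k) ⊗ₜ[A] s) = 0 := by
      rw [← hs, ← algebraMap_smul k a z, map_smul, hz, smul_zero]
    have h2 : s = 0 := by
      have : toFieldSpan (k := k) S s = 0 := by simpa [φ] using h1
      exact Subtype.ext (congrArg (fun x : fieldSpan k S ↦ (x : Ω)) this)
    have := eq_one_tmul_of_smul_eq (k := k) ha (c := z) (z := (0 : S)) (by rw [hs, h2, smul_zero])
    rw [this, tmul_zero]
  · have hle : Algebra.adjoin k (S : Set Ω) ≤ ((fieldSpan k S).val.comp φ).range := by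
      refine Algebra.adjoin_le fun s hs ↦ ⟨1 ⊗ₜ ⟨s, hs⟩, ?_⟩
      change ((φ (1 ⊗ₜ ⟨s, hs⟩) : fieldSpan k S) : Ω) = s
      simp only [φ, Algebra.TensorProduct.lift_tmul, map_one, one_mul]
      rfl
    intro x
    obtain ⟨z, hz⟩ := hle x.2
    exact ⟨z, Subtype.ext hz⟩

/-- `C₀` is the integral closure of `A` in `C = k ⊗ C₀`, so `S ⊗ C₀` is the integral closure of `S`
in `S ⊗ C`. The latter is a power of `F` by splitting, and `S` is integrally closed in `F`, so `S ⊗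
C₀` is a power of `S`. -/
lemma etale_tensor_of_forall_mem_fieldSpan [IsIntegrallyClosed A] [IsAlgClosed Ω] [Algebra.Etale A S] {C₀ : Type u} [CommRing C₀]
    [Algebra A C₀] [Algebra.IsIntegral A C₀] [Algebra.Etale k (k ⊗[A] C₀)]
    (hinj : Function.Injective fun z : C₀ ↦ (1 : k) ⊗ₜ[A] z)
    (hint : ∀ c : k ⊗[A] C₀, _root_.IsIntegral A c → ∃ z : C₀, c = 1 ⊗ₜ z)
    (h : ∀ (τ : k ⊗[A] C₀ →ₐ[k] Ω) (c : k ⊗[A] C₀), τ c ∈ fieldSpan k S) :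
    Algebra.Etale S (S ⊗[A] C₀) := by
  let F := fieldSpan k S
  let C := k ⊗[A] C₀
  let : Algebra S F := (toFieldSpan (k := k) S).toRingHom.toAlgebra
  have : IsScalarTower A S F := .of_algebraMap_eq' (toFieldSpan (k := k) S).comp_algebraMap.symm
  let e : k ⊗[A] S ≃ₐ[k] F := .ofBijective _ (lift_toFieldSpan_bijective k S)
  have he (s : S) : e (1 ⊗ₜ s) = algebraMap S F s := by
    simp [e]; rfl
  obtain ⟨J, _, ⟨eJ⟩⟩ := exists_algEquiv_pi_of_forall_mem F h
  -- `S` is integrally closed in `F`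
  have hS (x : F) (hx : _root_.IsIntegral S x) : ∃ s, algebraMap S F s = x := by
    let g : F →ₐ[S] S ⊗[A] k :=
      { ((Algebra.TensorProduct.comm A k S).toRingEquiv.toRingHom).comp e.symm.toRingEquiv.toRingHom
          with
        commutes' s := by
          change Algebra.TensorProduct.comm A k S (e.symm (algebraMap S F s)) = _
          rw [← he, AlgEquiv.symm_apply_apply]; rfl }
    obtain ⟨s, hs⟩ := exists_tmul_one_of_isIntegral (hx.map g)
    refine ⟨s, ?_⟩
    rw [← he]
    have h1 : Algebra.TensorProduct.comm A k S (e.symm x) = s ⊗ₜ 1 := hs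
    rw [← AlgEquiv.eq_symm_apply] at h1
    rw [← AlgEquiv.eq_symm_apply, h1]; rfl
  -- the integral closure of `S` in a power of `F`
  let ePi : (J → S) ≃ₐ[S] integralClosure S (J → F) := by
    let ι : (J → S) →ₐ[S] (J → F) := AlgHom.pi fun j ↦
      (IsScalarTower.toAlgHom S S F).comp (Pi.evalAlgHom S _ j)
    refine .ofBijective (ι.codRestrict _ fun f ↦ (Algebra.IsIntegral.isIntegral f).map ι) ⟨?_, ?_⟩
    · intro f g hfg
      funext j
      have hj : algebraMap S F (f j) = algebraMap S F (g j) := congrFun (congrArg Subtype.val hfg) j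
      exact Subtype.ext (congrArg (fun x : F ↦ (x : Ω)) hj)
    · intro f
      choose g hg using fun j ↦ hS (f.1 j) (f.2.map (Pi.evalAlgHom S _ j))
      exact ⟨g, Subtype.ext (funext hg)⟩
  let e0 : C₀ ≃ₐ[A] integralClosure A C := by
    let ι : C₀ →ₐ[A] C := Algebra.TensorProduct.includeRight
    refine .ofBijective (ι.codRestrict _ fun z ↦ (Algebra.IsIntegral.isIntegral z).map ι) ⟨?_, ?_⟩
    · exact fun z z' hz ↦ hinj (congrArg Subtype.val hz)
    · intro c
      obtain ⟨z, hz⟩ := hint c.1 c.2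
      exact ⟨z, Subtype.ext hz.symm⟩
  -- The chain is `S ⊗[A] C ≃ C ⊗[A] S ≃ C ⊗[k] (k ⊗[A] S) ≃ C ⊗[k] F ≃ F ⊗[k] C ≃ (J → F)`.
  let eS : S ⊗[A] C ≃ₐ[S] (J → F) :=
    .ofRingEquiv (f := (Algebra.TensorProduct.comm A S C).toRingEquiv.trans <|
      (Algebra.TensorProduct.cancelBaseChange A k k C S).symm.toRingEquiv.trans <|
      (Algebra.TensorProduct.congr (.refl : C ≃ₐ[k] C) e).toRingEquiv.trans <|
      (Algebra.TensorProduct.comm k C F).toRingEquiv.trans eJ.toRingEquiv) fun s ↦ by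
        change eJ (Algebra.TensorProduct.comm k C F (Algebra.TensorProduct.congr
          (.refl : C ≃ₐ[k] C) e ((Algebra.TensorProduct.cancelBaseChange A k k C S).symm
            (Algebra.TensorProduct.comm A S C (s ⊗ₜ 1))))) = _
        rw [Algebra.TensorProduct.comm_tmul, Algebra.TensorProduct.cancelBaseChange_symm_tmul,
          Algebra.TensorProduct.congr_apply, Algebra.TensorProduct.map_tmul]
        change eJ (e (1 ⊗ₜ s) ⊗ₜ 1) = _
        rw [he]
        exact eJ.commutes (algebraMap S F s)
  let eTot : S ⊗[A] C₀ ≃ₐ[S] (J → S) :=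
    (Algebra.TensorProduct.congr .refl e0).trans <|
      (AlgEquiv.ofBijective _ TensorProduct.toIntegralClosure_bijective_of_smooth).trans <|
      (AlgEquiv.mapIntegralClosure eS).trans ePi.symm
  exact .of_equiv eTot.symm

variable (k Ω) in
/-- Let `C₀` be a finite algebra over a normal domain `A` which is integrally closed in its generic
fibre. If the generic fibre is étale and all its geometric points are unramified, then `C₀` is
étale. -/
theorem etale_of_isUnramifiedSet [IsIntegrallyClosed A] [IsAlgClosed Ω] {C₀ : Type u} [CommRing C₀]
    [Algebra A C₀] [Module.Finite A C₀] [Algebra.Etale k (k ⊗[A] C₀)]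
    (hinj : Function.Injective fun z : C₀ ↦ (1 : k) ⊗ₜ[A] z)
    (hint : ∀ c : k ⊗[A] C₀, _root_.IsIntegral A c → ∃ z : C₀, c = 1 ⊗ₜ z)
    (h : ∀ (τ : k ⊗[A] C₀ →ₐ[k] Ω) (c : k ⊗[A] C₀), IsUnramifiedSet A k Ω {τ c}) :
    Algebra.Etale A C₀ := by
  obtain ⟨B, _, _, _, _, y, hy⟩ := exists_etale_point_forall_mem_adjoin h
  have := etale_range k y
  have : Module.Finite A y.range := .of_surjective y.rangeRestrict.toLinearMap
    y.rangeRestrict_surjective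
  have : FaithfulSMul A Ω := .trans A k Ω
  -- A finite injective extension is surjective on spectra; with the flatness of étale algebras this
  -- makes `y.range` faithfully flat, so étaleness descends.
  have : FaithfulSMul A y.range := by
    rw [faithfulSMul_iff_algebraMap_injective]
    intro a b hab
    exact FaithfulSMul.algebraMap_injective A Ω (congrArg Subtype.val hab)
  have := etale_tensor_of_forall_mem_fieldSpan (k := k) y.range hinj hint fun τ c ↦ hy τ c
  exact .of_etale_tensorProduct_of_faithfullyFlat y.range

end EtaleOfPoints

end

end LocalKernels

namespace LocalKernels

noncomputable section

open TensorProduct IsLocalRing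

/-! ### The étaleness criterion over a local ring, through its completion. -/

section LocalEtale

/-- The generic fibre of `A ⊗ S` is `k ⊗[K] L`, a base change of a finite separable field extension.
-/
lemma etale_tensor_of_isPushout (R A K k S L : Type u) [CommRing R] [CommRing A] [Algebra R A]
    [Field K] [Algebra R K] [Field k] [Algebra R k] [Algebra A k] [Algebra K k]
    [IsScalarTower R A k] [IsScalarTower R K k] [CommRing S] [Algebra R S] [Field L]
    [Algebra S L] [Algebra R L] [IsScalarTower R S L] [Algebra K L] [IsScalarTower R K L]
    [Algebra.IsPushout R K S L] [FiniteDimensional K L] [Algebra.IsSeparable K L] :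
    Algebra.Etale k (k ⊗[A] (A ⊗[R] S)) := by
  have h1 : Algebra.Etale K L := 
    ⟨Algebra.FormallyEtale.of_isSeparable K L, Algebra.FinitePresentation.of_finiteType.mp inferInstance⟩
  have h2 : Algebra.Etale K (K ⊗[R] S) := .of_equiv (Algebra.IsPushout.equiv R K S L).symm
  exact .of_equiv ((Algebra.TensorProduct.cancelBaseChange R K k k S).trans
    (Algebra.TensorProduct.cancelBaseChange R A k k S).symm)

lemma one_tmul_tmul {R A k S : Type*} [CommRing R] [CommRing A] [Algebra R A] [CommRing k]
    [Algebra A k] [CommRing S] [Algebra R S] (a : A) (s : S) :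
    (1 : k) ⊗ₜ[A] (a ⊗ₜ[R] s) = algebraMap A k a • ((1 : k) ⊗ₜ[A] ((1 : A) ⊗ₜ[R] s)) := by
  rw [algebraMap_smul, ← tmul_smul, smul_tmul', smul_eq_mul, mul_one]

/-- Let `S` be a finite algebra over a Noetherian local domain `R`, with generic fibre a finite
separable extension `L` of `K = Frac R`. If the completed local rings of `R` and `S` are normal
domains and all embeddings of `L` over `K` into an algebraic closure of the fraction field of the
completion `R̂` are unramified over `R̂`, then `S` is étale over `R`. -/
theorem etale_of_completion {R S : Type u} [CommRing R] [IsLocalRing R]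
    [IsNoetherianRing R] [CommRing S] [Algebra R S] [Module.Finite R S]
    (T : MaximalSpectrum S → Type u) [∀ q, CommRing (T q)] [∀ q, IsLocalRing (T q)]
    [∀ q, Algebra S (T q)] [∀ q, Algebra R (T q)] [∀ q, IsScalarTower R S (T q)]
    [∀ q, IsLocalization.AtPrime (T q) q.asIdeal]
    [∀ q, IsDomain (AdicCompletion (maximalIdeal (T q)) (T q))]
    [∀ q, IsIntegrallyClosed (AdicCompletion (maximalIdeal (T q)) (T q))]
    [IsDomain (AdicCompletion (maximalIdeal R) R)]
    [IsIntegrallyClosed (AdicCompletion (maximalIdeal R) R)]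
    (K L : Type u) [Field K] [Algebra R K] [IsFractionRing R K]
    [Field L] [Algebra S L] [FaithfulSMul S L] [Algebra R L] [IsScalarTower R S L]
    [Algebra K L] [IsScalarTower R K L] [FiniteDimensional K L] [Algebra.IsSeparable K L]
    [Algebra.IsPushout R K S L]
    (k Ω : Type u) [Field k] [Algebra (AdicCompletion (maximalIdeal R) R) k]
    [IsFractionRing (AdicCompletion (maximalIdeal R) R) k]
    [Algebra R k] [IsScalarTower R (AdicCompletion (maximalIdeal R) R) k]
    [Algebra K k] [IsScalarTower R K k] [Field Ω] [Algebra k Ω] [IsAlgClosure k Ω]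
    [Algebra (AdicCompletion (maximalIdeal R) R) Ω]
    [IsScalarTower (AdicCompletion (maximalIdeal R) R) k Ω]
    [Algebra K Ω] [IsScalarTower K k Ω]
    (h : ∀ (τ : L →ₐ[K] Ω) (l : L),
      IsUnramifiedSet (AdicCompletion (maximalIdeal R) R) k Ω {τ l}) :
    Algebra.Etale R S := by
  have := IsAlgClosure.isAlgebraic (R := k) (K := Ω)
  have := IsAlgClosure.isAlgClosed (R := k) (K := Ω)
  have : Module.Flat R K := IsLocalization.flat K (nonZeroDivisors R)
  have : Module.Flat R L := .trans R K L
  have : Module.FaithfullyFlat R (AdicCompletion (maximalIdeal R) R) := by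
    have : IsLocalHom (algebraMap R (AdicCompletion (maximalIdeal R) R)) := by
      refine ⟨fun r hr ↦ ?_⟩
      by_contra hr'
      have h0 : AdicCompletion.evalOneₐ (maximalIdeal R) (algebraMap R _ r) = 0 :=
        Ideal.Quotient.eq_zero_iff_mem.mpr hr'
      have h1 := hr.map (AdicCompletion.evalOneₐ (maximalIdeal R))
      rw [h0] at h1
      exact not_isUnit_zero h1
    exact .of_flat_of_isLocalHom
  have := etale_tensor_of_isPushout R (AdicCompletion (maximalIdeal R) R) K k S L
  let ι : S →ₗ[R] L := (IsScalarTower.toAlgHom R S L).toLinearMap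
  have hι : Function.Injective ι := FaithfulSMul.algebraMap_injective S L
  suffices Algebra.Etale (AdicCompletion (maximalIdeal R) R)
      (AdicCompletion (maximalIdeal R) R ⊗[R] S) from
    .of_etale_tensorProduct_of_faithfullyFlat (AdicCompletion (maximalIdeal R) R)
  refine etale_of_isUnramifiedSet k Ω (one_tmul_injective k fun a m ha hm ↦ ?_)
    (exists_one_tmul_of_isIntegral T ι hι k) fun τ c ↦ ?_
  · refine eq_zero_of_tmul_one_mul_eq_zero ι hι ha ?_
    rw [← hm]
    exact (Algebra.smul_def a m).symm
  · let : Algebra R Ω := ((algebraMap k Ω).comp (algebraMap R k)).toAlgebra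
    have : IsScalarTower R k Ω := .of_algebraMap_eq' rfl
    have : IsScalarTower R K Ω := .of_algebraMap_eq fun r ↦ by
      rw [IsScalarTower.algebraMap_apply R k Ω, IsScalarTower.algebraMap_apply K k Ω,
        ← IsScalarTower.algebraMap_apply R K k]
    have : IsScalarTower R (AdicCompletion (maximalIdeal R) R) Ω := .of_algebraMap_eq fun r ↦ by
      rw [IsScalarTower.algebraMap_apply R k Ω,
        IsScalarTower.algebraMap_apply (AdicCompletion (maximalIdeal R) R) k Ω,
        ← IsScalarTower.algebraMap_apply R _ k]
    let t : S →ₐ[R] Ω :=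
      ((τ.restrictScalars (AdicCompletion (maximalIdeal R) R)).comp
        Algebra.TensorProduct.includeRight |>.restrictScalars R).comp
        Algebra.TensorProduct.includeRight
    -- Since `L = K ⊗[R] S`, the restriction of `τ` to `S` extends to an embedding of `L`. The
    -- values of `τ` are `k`-combinations of values of this embedding, and these are unramified by
    -- hypothesis.
    let t' : L →ₐ[K] Ω :=
      (Algebra.TensorProduct.lift (Algebra.ofId K Ω) t (fun _ _ ↦ .all _ _)).comp
        (Algebra.IsPushout.equiv R K S L).symm.toAlgHom
    have ht (s : S) : t' (algebraMap S L s) = t s := by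
      simp [t', Algebra.IsPushout.equiv_symm_algebraMap_right]
    rw [← mem_unramifiedField]
    induction c with
    | zero => rw [map_zero]; exact zero_mem _
    | add x y hx hy => rw [map_add]; exact add_mem hx hy
    | tmul x z =>
      rw [show x ⊗ₜ[AdicCompletion (maximalIdeal R) R] z = x • (1 ⊗ₜ z) by
        rw [smul_tmul', smul_eq_mul, mul_one], map_smul]
      refine IntermediateField.smul_mem _ ?_
      induction z with
      | zero => rw [tmul_zero, map_zero]; exact zero_mem _
      | add x y hx hy => rw [tmul_add, map_add]; exact add_mem hx hy
      | tmul a s =>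
        rw [one_tmul_tmul, map_smul]
        refine IntermediateField.smul_mem _ ?_
        rw [mem_unramifiedField]
        change IsUnramifiedSet _ k Ω {t s}
        rw [← ht]
        exact h t' _

end LocalEtale

end

end LocalKernels

namespace LocalKernels

noncomputable section

open TensorProduct IsLocalRing Limits

lemma mem_fixingSubgroup_adjoin_simple_iff {k Ω : Type*} [Field k] [Field Ω] [Algebra k Ω] (c : Ω)
    (σ : Gal(Ω/k)) : σ ∈ (IntermediateField.adjoin k {c}).fixingSubgroup ↔ σ c = c := by
  constructor
  · intro h
    rw [IntermediateField.mem_fixingSubgroup_iff] at h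
    exact h c (IntermediateField.mem_adjoin_simple_self k c)
  · intro h
    rw [← Subgroup.zpowers_le, ← IntermediateField.le_iff_le, IntermediateField.adjoin_simple_le_iff]
    rintro ⟨τ, hτ⟩
    obtain ⟨n, rfl⟩ := hτ
    exact MulAction.mem_stabilizer_iff.mp
      (zpow_mem (show σ ∈ MulAction.stabilizer Gal(Ω/k) c from h) n)

/-! ### Kernels of the homomorphisms to fundamental groups -/

section Kernel

variable {X : Scheme.{u}} {k : Type u} [Field k] (f : Spec (.of k) ⟶ X)
  (Ω : Type u) [Field Ω] [Algebra k Ω]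

lemma mem_ker_galToPi1_iff (σ : Gal(Ω/k)) :
    σ ∈ (galToPi1 f Ω).ker ↔ ∀ (Y : Scheme.{u}) (g : Y ⟶ X) [IsFinite g] [Etale g]
      (y : Spec (.of Ω) ⟶ Y), y ≫ g = geometricPoint f Ω →
        Spec.map (CommRingCat.ofHom (σ : Ω →+* Ω)) ≫ y = y := by
  rw [MonoidHom.mem_ker]
  constructor
  · intro h Y g _ _ y hy
    let Y' : FiniteEtaleOver X := MorphismProperty.Over.mk ⊤ g ⟨‹_›, ‹_›⟩
    have h1 : (galToPi1 f Ω σ).hom.app Y' (Over.homMk y hy) = Over.homMk y hy := by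
      rw [h]; rfl
    rw [galToPi1_hom_app] at h1
    exact congrArg CommaMorphism.left h1
  · intro h
    ext Y y
    change specGal f Ω σ ≫ y = y
    have : IsFinite Y.hom := Y.prop.1
    have : Etale Y.hom := Y.prop.2
    apply Over.OverMorphism.ext
    exact h Y.left Y.hom y.left (Over.w y)

variable {Ω} in
/-- The ring map on global sections of a morphism from the spectrum of a ring. -/
def pointValue {Y : Scheme.{u}} (y : Spec (.of Ω) ⟶ Y) : Γ(Y, ⊤) →+* Ω :=
  (y.appTop ≫ (Scheme.ΓSpecIso (.of Ω)).hom).hom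

variable {Ω} in
lemma pointValue_specMap {Y : Scheme.{u}} (y : Spec (.of Ω) ⟶ Y) (σ : Ω →+* Ω) (b : Γ(Y, ⊤)) :
    pointValue (Spec.map (CommRingCat.ofHom σ) ≫ y) b = σ (pointValue y b) := by
  have h := Scheme.ΓSpecIso_naturality (CommRingCat.ofHom σ)
  rw [pointValue, pointValue, Scheme.Hom.comp_appTop, Category.assoc, h]
  rfl

variable {Ω} in
lemma ext_pointValue {Y : Scheme.{u}} [IsAffine Y] {y y' : Spec (.of Ω) ⟶ Y}
    (h : ∀ b, pointValue y b = pointValue y' b) : y = y' := by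
  apply ext_of_isAffine
  rw [← cancel_mono (Scheme.ΓSpecIso (.of Ω)).hom]
  ext b
  exact h b

/-- A cover of `X` need not be affine, but its pullback to `Spec k` is, and there fixing a point
means fixing its values on global sections. The kernel is thus an intersection of stabilizers of
elements of `Ω`, which are closed in the Krull topology. -/
lemma isClosed_ker_galToPi1 [Algebra.IsAlgebraic k Ω] :
    IsClosed ((galToPi1 f Ω).ker : Set Gal(Ω/k)) := by
  have hcl (c : Ω) : IsClosed {σ : Gal(Ω/k) | σ c = c} := by
    have : FiniteDimensional k (IntermediateField.adjoin k {c}) :=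
      IntermediateField.adjoin.finiteDimensional (Algebra.IsIntegral.isIntegral c)
    have := IntermediateField.fixingSubgroup_isClosed (IntermediateField.adjoin k {c})
    convert this using 1
    ext σ
    exact (mem_fixingSubgroup_adjoin_simple_iff c σ).symm
  have key (σ : Gal(Ω/k)) : σ ∈ (galToPi1 f Ω).ker ↔ ∀ (Y : Scheme.{u}) (g : Y ⟶ X) [IsFinite g]
      [Etale g] (y : Spec (.of Ω) ⟶ pullback g f)
      (_ : y ≫ pullback.snd g f = Spec.map (CommRingCat.ofHom (algebraMap k Ω))) (b),
        σ (pointValue y b) = pointValue y b := by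
    have hσ : Spec.map (CommRingCat.ofHom (σ : Ω →+* Ω)) ≫
        Spec.map (CommRingCat.ofHom (algebraMap k Ω)) =
        Spec.map (CommRingCat.ofHom (algebraMap k Ω)) := by
      rw [← Spec.map_comp, ← CommRingCat.ofHom_comp]
      congr 2
      ext a
      exact σ.commutes a
    rw [mem_ker_galToPi1_iff]
    constructor
    · intro h Y g _ _ y hy b
      have h1 : Spec.map (CommRingCat.ofHom (σ : Ω →+* Ω)) ≫ y = y := by
        apply pullback.hom_ext
        · rw [Category.assoc]
          refine h Y g _ ?_
          rw [Category.assoc, pullback.condition, reassoc_of% hy, geometricPoint]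
        · rw [Category.assoc, hy, hσ]
      rw [← RingHom.coe_coe σ, ← pointValue_specMap, h1]
    · intro h Y g _ _ y hy
      replace hy : y ≫ g = Spec.map (CommRingCat.ofHom (algebraMap k Ω)) ≫ f := hy
      have : IsAffine (pullback g f) := isAffine_of_isAffineHom (pullback.snd g f)
      have h1 : Spec.map (CommRingCat.ofHom (σ : Ω →+* Ω)) ≫
          pullback.lift (f := g) (g := f) y _ hy = pullback.lift (f := g) (g := f) y _ hy := by
        apply ext_pointValue
        intro b
        rw [pointValue_specMap]
        exact h Y g _ (pullback.lift_snd _ _ _) b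
      have h2 := congrArg (· ≫ pullback.fst g f) h1
      rwa [Category.assoc, pullback.lift_fst] at h2
  have : ((galToPi1 f Ω).ker : Set Gal(Ω/k)) = ⋂ (Y : Scheme.{u}) (g : Y ⟶ X) (_ : IsFinite g)
      (_ : Etale g) (y : Spec (.of Ω) ⟶ pullback g f)
      (_ : y ≫ pullback.snd g f = Spec.map (CommRingCat.ofHom (algebraMap k Ω))) (b),
        {σ : Gal(Ω/k) | σ (pointValue y b) = pointValue y b} := by
    ext σ
    simp only [Set.mem_iInter, Set.mem_ofPred_eq, SetLike.mem_coe]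
    exact key σ
  rw [this]
  refine isClosed_iInter fun Y ↦ isClosed_iInter fun g ↦ isClosed_iInter fun _ ↦
    isClosed_iInter fun _ ↦ isClosed_iInter fun y ↦ isClosed_iInter fun hy ↦
      isClosed_iInter fun b ↦ hcl _

end Kernel

/-- An automorphism fixing all values of finite étale `A`-algebras in `Ω` is in the kernel. -/
lemma mem_ker_galToPi1_of_forall_etale {A k Ω : Type u} [CommRing A] [Field k] [Algebra A k]
    [Field Ω] [Algebra k Ω] [Algebra A Ω] [IsScalarTower A k Ω] (σ : Gal(Ω/k))
    (h : ∀ (B : Type u) [CommRing B] [Algebra A B] [Module.Finite A B]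
      [Algebra.Etale A B] (y : B →ₐ[A] Ω) (b : B), σ (y b) = y b) :
    σ ∈ (galToPi1 (Spec.map (CommRingCat.ofHom (algebraMap A k))) Ω).ker := by
  rw [mem_ker_galToPi1_iff]
  intro Y g _ _ y hy
  have : IsAffine Y := isAffine_of_isAffineHom g
  apply ext_pointValue
  intro b
  rw [pointValue_specMap]
  let φ : A →+* Γ(Y, ⊤) := ((Scheme.ΓSpecIso (.of A)).inv ≫ g.appTop).hom
  let : Algebra A Γ(Y, ⊤) := φ.toAlgebra
  have hfin : Module.Finite A Γ(Y, ⊤) := by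
    have h1 : g.appTop.hom.Finite := g.finite_appTop
    exact h1.comp (RingHom.Finite.of_surjective _ (ConcreteCategory.bijective_of_isIso
      (Scheme.ΓSpecIso (.of A)).inv).2)
  have het : Algebra.Etale A Γ(Y, ⊤) := by
    have h1 : g.appTop.hom.Etale :=
      (HasRingHomProperty.iff_of_isAffine (P := @Etale) (f := g)).mp inferInstance
    have h2 : φ.Etale := RingHom.Etale.stableUnderComposition _ _
      (.of_bijective (ConcreteCategory.bijective_of_isIso (Scheme.ΓSpecIso (.of A)).inv)) h1
    exact h2
  refine h Γ(Y, ⊤) { pointValue y with commutes' := fun a ↦ ?_ } b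
  have h1 : y ≫ g = Spec.map (CommRingCat.ofHom (algebraMap A Ω)) := by
    rw [hy, geometricPoint, ← Spec.map_comp, ← CommRingCat.ofHom_comp,
      ← IsScalarTower.algebraMap_eq]
  have h2 : (Scheme.ΓSpecIso (.of A)).inv ≫ g.appTop ≫ y.appTop ≫
      (Scheme.ΓSpecIso (.of Ω)).hom = CommRingCat.ofHom (algebraMap A Ω) := by
    rw [← Scheme.Hom.comp_appTop_assoc, h1, Scheme.ΓSpecIso_naturality, Iso.inv_hom_id_assoc]
  exact congrArg (fun r ↦ r.hom a) h2

/-- The restriction homomorphism maps the kernel upstairs to the kernel downstairs. -/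
lemma galRestrict_mem_ker {X X' : Scheme.{u}} {k k' Ω Ω' : Type u} [Field k] [Field k'] [Field Ω]
    [Field Ω'] [Algebra k Ω] [Algebra k' Ω'] [Normal k Ω] (f : Spec (.of k) ⟶ X)
    (f' : Spec (.of k') ⟶ X') (h : X' ⟶ X) (i : k →+* k') (ω : Ω →+* Ω')
    (hω : ω.comp (algebraMap k Ω) = (algebraMap k' Ω').comp i)
    (hf : Spec.map (CommRingCat.ofHom i) ≫ f = f' ≫ h) {σ : Gal(Ω'/k')}
    (hσ : σ ∈ (galToPi1 f' Ω').ker) : galRestrict i ω hω σ ∈ (galToPi1 f Ω).ker := by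
  rw [mem_ker_galToPi1_iff] at hσ ⊢
  intro Y g _ _ y hy
  have hω' : Spec.map (CommRingCat.ofHom ω) ≫ Spec.map (CommRingCat.ofHom (algebraMap k Ω)) =
      Spec.map (CommRingCat.ofHom (algebraMap k' Ω')) ≫ Spec.map (CommRingCat.ofHom i) := by
    rw [← Spec.map_comp, ← Spec.map_comp, ← CommRingCat.ofHom_comp, ← CommRingCat.ofHom_comp, hω]
  have hy' : (Spec.map (CommRingCat.ofHom ω) ≫ y) ≫ g = geometricPoint f' Ω' ≫ h := by
    rw [Category.assoc, hy, geometricPoint, geometricPoint, reassoc_of% hω', hf, Category.assoc]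
  have h1 := hσ (pullback g h) (pullback.snd g h) (pullback.lift _ _ hy') (pullback.lift_snd _ _ _)
  have h2 := congrArg (· ≫ pullback.fst g h) h1
  rw [Category.assoc, pullback.lift_fst] at h2
  have h3 : Spec.map (CommRingCat.ofHom (σ : Ω' →+* Ω')) ≫ Spec.map (CommRingCat.ofHom ω) =
      Spec.map (CommRingCat.ofHom ω) ≫
        Spec.map (CommRingCat.ofHom (galRestrict i ω hω σ : Ω →+* Ω)) := by
    rw [← Spec.map_comp, ← Spec.map_comp, ← CommRingCat.ofHom_comp, ← CommRingCat.ofHom_comp]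
    congr 2
    ext a
    exact (galRestrict_apply i ω hω σ a).symm
  rw [reassoc_of% h3] at h2
  -- `Spec ω` is flat and surjective, hence an epimorphism, so it can be cancelled.
  have : Flat (Spec.map (CommRingCat.ofHom ω)) := by
    rw [Flat.SpecMap_iff]
    let : Algebra Ω Ω' := ω.toAlgebra
    change ω.Flat
    exact (inferInstance : Module.Flat Ω Ω')
  have : Surjective (Spec.map (CommRingCat.ofHom ω)) := ⟨fun z ↦
    ⟨(⊥ : PrimeSpectrum Ω'), Subsingleton.elim (α := PrimeSpectrum Ω) _ _⟩⟩
  rwa [cancel_epi] at h2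

lemma functionFieldToCompletedField_algebraMap (X : Scheme.{u}) [IsIntegral X]
    [IsLocallyNoetherian X] (x : X) [IsDomain (CompletedStalk X x)] (a : X.presheaf.stalk x) :
    functionFieldToCompletedField X x (algebraMap (X.presheaf.stalk x) X.functionField a) =
      algebraMap (CompletedStalk X x) (CompletedField X x)
        (algebraMap (X.presheaf.stalk x) (CompletedStalk X x) a) := by
  delta functionFieldToCompletedField
  exact IsFractionRing.lift_algebraMap (K := X.functionField)
    (stalk_to_completedField_injective X x) a

lemma specMap_functionFieldToCompletedField (X : Scheme.{u}) [IsIntegral X] [IsLocallyNoetherian X]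
    (x : X) [IsDomain (CompletedStalk X x)] :
    Spec.map (CommRingCat.ofHom (functionFieldToCompletedField X x)) ≫ specFunctionField X =
      specCompletedField X x ≫ Spec.map (CommRingCat.ofHom
        (algebraMap (X.presheaf.stalk x) (CompletedStalk X x))) ≫ X.fromSpecStalk x := by
  have h1 : X.presheaf.stalkSpecializes (genericPoint_specializes x) ≫
      CommRingCat.ofHom (functionFieldToCompletedField X x) =
      CommRingCat.ofHom (algebraMap (X.presheaf.stalk x) (CompletedStalk X x)) ≫
        CommRingCat.ofHom (algebraMap (CompletedStalk X x) (CompletedField X x)) :=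
    CommRingCat.hom_ext (RingHom.ext (functionFieldToCompletedField_algebraMap X x))
  rw [specFunctionField, ← Scheme.SpecMap_stalkSpecializes_fromSpecStalk
    (genericPoint_specializes x), specCompletedField]
  have h2 := (Spec.map_comp _ _).symm.trans ((congrArg Spec.map h1).trans (Spec.map_comp _ _))
  exact (Category.assoc _ _ _).symm.trans
    ((congrArg (· ≫ X.fromSpecStalk x) h2).trans (Category.assoc _ _ _))

end

end LocalKernels

namespace LocalKernels

noncomputable section

open TensorProduct IsLocalRing

/-! ### Étaleness of integral closures at primes -/

/-- `Q` survives in `S`, so the local ring of `B` at `Q` is a local ring of `S` and is formally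
étale over `P` through `R` and `S`. Only `≤ p` is required, so points over generizations of `p` are
covered too. -/
lemma isEtaleAt_of_isLocalization {P B R S : Type u} [CommRing P] [CommRing B] [Algebra P B]
    [CommRing R] [Algebra P R] [CommRing S] [Algebra R S] [Algebra B S] [Algebra P S]
    [IsScalarTower P R S] [IsScalarTower P B S] (p : Ideal P) [p.IsPrime]
    [IsLocalization.AtPrime R p] [IsLocalization (Algebra.algebraMapSubmonoid B p.primeCompl) S]
    [Algebra.Etale R S] (Q : Ideal B) [Q.IsPrime] (hQ : Q.comap (algebraMap P B) ≤ p) :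
    Algebra.IsEtaleAt P Q := by
  have hdis : Disjoint (Algebra.algebraMapSubmonoid B p.primeCompl : Set B) Q := by
    rw [Set.disjoint_left]
    rintro _ ⟨a, ha, rfl⟩ hmem
    exact ha (hQ hmem)
  have hprime := IsLocalization.isPrime_of_isPrime_disjoint _ S Q ‹_› hdis
  have hcomap := IsLocalization.under_map_of_isPrime_disjoint _ S (I := Q) ‹_› hdis
  generalize Q.map (algebraMap B S) = q at hprime hcomap
  subst hcomap
  have := IsLocalization.isLocalization_isLocalization_atPrime_isLocalization
    (Algebra.algebraMapSubmonoid B p.primeCompl) (Localization.AtPrime q) q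
  have h1 : Algebra.FormallyEtale P R := .of_isLocalization p.primeCompl
  have h2 : Algebra.FormallyEtale P S := .comp P R S
  have h3 : Algebra.FormallyEtale S (Localization.AtPrime q) := .of_isLocalization q.primeCompl
  have h4 : Algebra.FormallyEtale P (Localization.AtPrime q) := .comp P S _
  exact .of_equiv ((IsLocalization.algEquiv (q.comap (algebraMap B S)).primeCompl
    (Localization.AtPrime q) (Localization.AtPrime (q.comap (algebraMap B S)))).restrictScalars P)

/-- `R ⊗[P] B` localizes `B` over `p`; its maximal ideals correspond to primes of `B` above `p`,
with the same local rings, so `etale_of_completion` applies. `hT` is phrased up to isomorphism so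
that stalks of a scheme can serve as `T`. -/
lemma isEtaleAt_of_completion {P B R : Type u} [CommRing P] [IsDomain P] [IsNoetherianRing P]
    [IsIntegrallyClosed P] [CommRing B] [Algebra P B] (p : Ideal P) [p.IsPrime]
    [CommRing R] [IsLocalRing R] [Algebra P R] [IsLocalization.AtPrime R p]
    [IsDomain (AdicCompletion (maximalIdeal R) R)]
    [IsIntegrallyClosed (AdicCompletion (maximalIdeal R) R)]
    (K L : Type u) [Field K] [Algebra P K] [IsFractionRing P K] [Algebra R K] [IsScalarTower P R K]
    [Field L] [Algebra B L] [Algebra P L] [IsScalarTower P B L] [Algebra K L] [IsScalarTower P K L]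
    [FiniteDimensional K L] [Algebra.IsSeparable K L] [IsIntegralClosure B P L]
    (hT : ∀ Q : Ideal B, [Q.IsPrime] → Q.comap (algebraMap P B) = p →
      ∃ (T : Type u) (_ : CommRing T) (_ : IsLocalRing T) (_ : Localization.AtPrime Q ≃+* T),
        IsDomain (AdicCompletion (maximalIdeal T) T) ∧
          IsIntegrallyClosed (AdicCompletion (maximalIdeal T) T))
    (k Ω : Type u) [Field k] [Algebra (AdicCompletion (maximalIdeal R) R) k]
    [IsFractionRing (AdicCompletion (maximalIdeal R) R) k] [Algebra R k]
    [IsScalarTower R (AdicCompletion (maximalIdeal R) R) k] [Algebra K k] [IsScalarTower R K k]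
    [Field Ω] [Algebra k Ω] [IsAlgClosure k Ω] [Algebra (AdicCompletion (maximalIdeal R) R) Ω]
    [IsScalarTower (AdicCompletion (maximalIdeal R) R) k Ω] [Algebra K Ω] [IsScalarTower K k Ω]
    (h : ∀ (τ : L →ₐ[K] Ω) (l : L),
      IsUnramifiedSet (AdicCompletion (maximalIdeal R) R) k Ω {τ l})
    (Q : Ideal B) [Q.IsPrime] (hQ : Q.comap (algebraMap P B) ≤ p) :
    Algebra.IsEtaleAt P Q := by
  have : IsNoetherianRing R := IsLocalization.isNoetherianRing p.primeCompl R inferInstance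
  have hRK : IsFractionRing R K :=
    .isFractionRing_of_isDomain_of_isLocalization p.primeCompl R K
  have : Module.Finite P B := IsIntegralClosure.finite P K L B
  have : FaithfulSMul B L := (faithfulSMul_iff_algebraMap_injective B L).mpr
    (IsIntegralClosure.algebraMap_injective B P L)
  have : IsDomain B := (FaithfulSMul.algebraMap_injective B L).isDomain
  have hBL : IsFractionRing B L := IsIntegralClosure.isFractionRing_of_finite_extension P K L B
  have : FaithfulSMul P L := by
    rw [faithfulSMul_iff_algebraMap_injective, IsScalarTower.algebraMap_eq P K L]
    exact (algebraMap K L).injective.comp (IsFractionRing.injective P K)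
  have : FaithfulSMul P B := by
    rw [faithfulSMul_iff_algebraMap_injective]
    have := FaithfulSMul.algebraMap_injective P L
    rw [IsScalarTower.algebraMap_eq P B L, RingHom.coe_comp] at this
    exact this.of_comp
  let : Algebra R L := ((algebraMap K L).comp (algebraMap R K)).toAlgebra
  have : IsScalarTower R K L := .of_algebraMap_eq' rfl
  have : IsScalarTower P R L := .of_algebraMap_eq fun a ↦ by
    rw [IsScalarTower.algebraMap_apply R K L, ← IsScalarTower.algebraMap_apply P R K,
      ← IsScalarTower.algebraMap_apply P K L]
  let : Algebra B (R ⊗[P] B) := Algebra.TensorProduct.rightAlgebra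
  let ψ : R ⊗[P] B →ₐ[R] L := Algebra.TensorProduct.lift (Algebra.ofId R L)
    (IsScalarTower.toAlgHom P B L) fun _ _ ↦ Commute.all _ _
  let : Algebra (R ⊗[P] B) L := ψ.toRingHom.toAlgebra
  have : IsScalarTower R (R ⊗[P] B) L := .of_algebraMap_eq fun a ↦ (ψ.commutes a).symm
  have : IsScalarTower B (R ⊗[P] B) L := .of_algebraMap_eq fun b ↦ by
    change _ = ψ (1 ⊗ₜ b)
    simp [ψ]
  have : IsScalarTower P (R ⊗[P] B) L := .of_algebraMap_eq fun a ↦ by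
    rw [IsScalarTower.algebraMap_apply P R (R ⊗[P] B), ← IsScalarTower.algebraMap_apply R _ L,
      ← IsScalarTower.algebraMap_apply P R L]
  have hSloc : IsLocalization (Algebra.algebraMapSubmonoid B p.primeCompl) (R ⊗[P] B) :=
    inferInstance
  have hle : Algebra.algebraMapSubmonoid B p.primeCompl ≤ nonZeroDivisors B := by
    rintro _ ⟨a, ha, rfl⟩
    refine mem_nonZeroDivisors_of_ne_zero fun h0 ↦ ha ?_
    rw [(map_eq_zero_iff _ (FaithfulSMul.algebraMap_injective P B)).mp h0]
    exact zero_mem p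
  have : IsDomain (R ⊗[P] B) := IsLocalization.isDomain_of_le_nonZeroDivisors _ hle
  have hSL : IsFractionRing (R ⊗[P] B) L := .isFractionRing_of_isDomain_of_isLocalization
    (Algebra.algebraMapSubmonoid B p.primeCompl) (R ⊗[P] B) L
  have : FaithfulSMul (R ⊗[P] B) L := (faithfulSMul_iff_algebraMap_injective _ _).mpr
    (IsFractionRing.injective _ _)
  have hpush : Algebra.IsPushout P K B L := by
    have : IsLocalization (Algebra.algebraMapSubmonoid B (nonZeroDivisors P)) L := inferInstance
    exact (Algebra.isPushout_of_isLocalization (nonZeroDivisors P) K B L).symm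
  have hpush' : Algebra.IsPushout R K (R ⊗[P] B) L := by
    rwa [← Algebra.IsPushout.comp_iff P R B (R ⊗[P] B)]
  have hex (q : MaximalSpectrum (R ⊗[P] B)) :
      ∃ (T : Type u) (_ : CommRing T) (_ : IsLocalRing T)
        (_ : Localization.AtPrime q.asIdeal ≃+* T), IsDomain (AdicCompletion (maximalIdeal T) T) ∧
          IsIntegrallyClosed (AdicCompletion (maximalIdeal T) T) := by
    have hq : q.asIdeal.comap (algebraMap R (R ⊗[P] B)) = maximalIdeal R :=
      IsLocalRing.eq_maximalIdeal (Ideal.isMaximal_comap_of_isIntegral_of_isMaximal q.asIdeal)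
    obtain ⟨T, _, _, e, hT⟩ := hT (q.asIdeal.comap (algebraMap B (R ⊗[P] B))) <| by
      rw [Ideal.comap_comap, ← IsScalarTower.algebraMap_eq,
        IsScalarTower.algebraMap_eq P R (R ⊗[P] B), ← Ideal.comap_comap, hq]
      exact IsLocalization.AtPrime.under_maximalIdeal R p
    have := IsLocalization.isLocalization_isLocalization_atPrime_isLocalization
      (Algebra.algebraMapSubmonoid B p.primeCompl) (Localization.AtPrime q.asIdeal) q.asIdeal
    exact ⟨T, _, _, (IsLocalization.algEquiv
      (q.asIdeal.comap (algebraMap B (R ⊗[P] B))).primeCompl (Localization.AtPrime q.asIdeal)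
      (Localization.AtPrime (q.asIdeal.comap (algebraMap B (R ⊗[P] B))))).toRingEquiv.trans e, hT⟩
  choose T _ _ e hdom hint using hex
  let (q : MaximalSpectrum (R ⊗[P] B)) : Algebra (R ⊗[P] B) (T q) :=
    ((e q).toRingHom.comp (algebraMap _ _)).toAlgebra
  let (q : MaximalSpectrum (R ⊗[P] B)) : Algebra R (T q) :=
    ((algebraMap (R ⊗[P] B) (T q)).comp (algebraMap R (R ⊗[P] B))).toAlgebra
  have (q : MaximalSpectrum (R ⊗[P] B)) : IsScalarTower R (R ⊗[P] B) (T q) :=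
    .of_algebraMap_eq' rfl
  have (q : MaximalSpectrum (R ⊗[P] B)) : IsLocalization.AtPrime (T q) q.asIdeal :=
    IsLocalization.isLocalization_of_algEquiv q.asIdeal.primeCompl
      { e q with commutes' := fun _ ↦ rfl }
  have : Algebra.Etale R (R ⊗[P] B) := etale_of_completion T K L k Ω h
  exact isEtaleAt_of_isLocalization (R := R) (S := R ⊗[P] B) p Q hQ

end

end LocalKernels

namespace LocalKernels

noncomputable section

open TensorProduct IsLocalRing

/-! ### Sections of the normalization in a field extension -/

lemma specMap_fromSpecStalk_appLE {X : Scheme.{u}} (x : X) {F : CommRingCat.{u}}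
    (a : X.presheaf.stalk x ⟶ F) {U : X.Opens} (hx : x ∈ U)
    (e : ⊤ ≤ (Spec.map a ≫ X.fromSpecStalk x) ⁻¹ᵁ U) :
    (Spec.map a ≫ X.fromSpecStalk x).appLE U ⊤ e ≫ (Scheme.ΓSpecIso F).hom =
      X.presheaf.germ U x hx ≫ a := by
  have e' : ⊤ ≤ Spec.map a ⁻¹ᵁ (X.fromSpecStalk x ⁻¹ᵁ U) := e
  have h : (Spec.map a ≫ X.fromSpecStalk x).appLE U ⊤ e =
    (X.fromSpecStalk x).app U ≫ (Spec.map a).appLE _ ⊤ e' := Scheme.Hom.comp_appLE _ _ _ _ _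
  rw [h, Scheme.fromSpecStalk_app hx, Category.assoc, Category.assoc, Category.assoc,
    Scheme.Hom.map_appLE_assoc]
  have h2 : (Spec.map a).appLE ⊤ ⊤ le_top = (Spec.map a).appTop := Scheme.Hom.appLE_eq_app _
  rw [h2, Scheme.ΓSpecIso_naturality, Iso.inv_hom_id_assoc]

lemma appLE_congr_hom {X Y : Scheme.{u}} {f g : X ⟶ Y} (h : f = g) {U : Y.Opens} {V : X.Opens}
    (e : V ≤ f ⁻¹ᵁ U) (e' : V ≤ g ⁻¹ᵁ U) : f.appLE U V e = g.appLE U V e' := by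
  subst h
  rfl

section Sections

variable (X : Scheme.{u}) [IsIntegral X] (L : Type u) [Field L] [Algebra X.functionField L]

/-- The morphism `Spec L ⟶ Spec K ⟶ X`. -/
abbrev specExtension : Spec (.of L) ⟶ X :=
  Spec.map (CommRingCat.ofHom (algebraMap X.functionField L)) ≫ specFunctionField X

lemma specExtension_preimage (U : X.Opens) [hU : Nonempty U] :
    specExtension X L ⁻¹ᵁ U = ⊤ := by
  rw [eq_top_iff]
  intro z _
  have hη : genericPoint X ∈ U :=
    ((genericPoint_spec X).mem_open_set_iff U.isOpen).mpr (by simpa using hU)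
  have h1 : specExtension X L z ∈ Set.range (X.fromSpecStalk (genericPoint X)) :=
    ⟨_, (Scheme.Hom.comp_apply _ _ z).symm⟩
  rw [Scheme.range_fromSpecStalk] at h1
  exact h1.mem_open U.isOpen hη

lemma specExtension_appLE (U : X.Opens) [Nonempty U] :
    (specExtension X L).appLE U ⊤ (specExtension_preimage X L U).ge ≫
      (Scheme.ΓSpecIso (.of L)).hom =
    X.germToFunctionField U ≫ CommRingCat.ofHom (algebraMap X.functionField L) := by
  have hη : genericPoint X ∈ U :=
    ((genericPoint_spec X).mem_open_set_iff U.isOpen).mpr (by simpa using ‹Nonempty U›)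
  exact specMap_fromSpecStalk_appLE (genericPoint X)
    (CommRingCat.ofHom (algebraMap X.functionField L)) hη _

/-- Sections of `Spec L` over the preimage of a nonempty open of `X` are elements of `L`. -/
def preimageSectionsEquiv (U : X.Opens) [Nonempty U] :
    Γ(Spec (.of L), specExtension X L ⁻¹ᵁ U) ≅ .of L :=
  (Spec (.of L)).presheaf.mapIso (eqToIso (specExtension_preimage X L U).symm).op ≪≫
    Scheme.ΓSpecIso (.of L)

lemma preimageSectionsEquiv_app (U : X.Opens) [Nonempty U] (a : Γ(X, U)) :
    (preimageSectionsEquiv X L U).hom ((specExtension X L).app U a) =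
      algebraMap X.functionField L (algebraMap Γ(X, U) X.functionField a) := by
  have h := specExtension_appLE X L U
  rw [Scheme.Hom.appLE, Category.assoc] at h
  exact congrArg (fun r ↦ r.hom a) h

variable [IsLocallyNoetherian X]

/-- The structure morphism of the normalization of `X` in `L`. -/
def normalizationMap : normalizationIn X L ⟶ X := (specExtension X L).fromNormalization

/-- The generic point `Spec L` of the normalization of `X` in `L`. -/
def toNormalizationIn : Spec (.of L) ⟶ normalizationIn X L := (specExtension X L).toNormalization

lemma toNormalizationIn_normalizationMap :
    toNormalizationIn X L ≫ normalizationMap X L = specExtension X L :=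
  (specExtension X L).toNormalization_fromNormalization

instance : IsIntegralHom (normalizationMap X L) :=
  inferInstanceAs (IsIntegralHom (specExtension X L).fromNormalization)

lemma top_le_toNormalizationIn_preimage (U : X.Opens) [Nonempty U] :
    ⊤ ≤ toNormalizationIn X L ⁻¹ᵁ (normalizationMap X L ⁻¹ᵁ U) := by
  rw [← Scheme.Hom.comp_preimage, toNormalizationIn_normalizationMap, specExtension_preimage]

/-- The embedding in `L` of the ring of sections of the normalization over an open of `X`. -/
def sectionsToField (U : X.Opens) [Nonempty U] :
    Γ(normalizationIn X L, normalizationMap X L ⁻¹ᵁ U) →+* L :=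
  ((toNormalizationIn X L).appLE (normalizationMap X L ⁻¹ᵁ U) ⊤
    (top_le_toNormalizationIn_preimage X L U) ≫ (Scheme.ΓSpecIso (.of L)).hom).hom

lemma sectionsToField_app (U : X.Opens) [Nonempty U] (a : Γ(X, U)) :
    sectionsToField X L U ((normalizationMap X L).app U a) =
      algebraMap X.functionField L (algebraMap Γ(X, U) X.functionField a) := by
  have h := specExtension_appLE X L U
  have h2 : (normalizationMap X L).app U ≫ (toNormalizationIn X L).appLE
      (normalizationMap X L ⁻¹ᵁ U) ⊤ (top_le_toNormalizationIn_preimage X L U) =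
      (specExtension X L).appLE U ⊤ (specExtension_preimage X L U).ge := by
    exact (Scheme.Hom.comp_appLE _ _ U ⊤ _).symm.trans
      (appLE_congr_hom (toNormalizationIn_normalizationMap X L) _ _)
  rw [← h2, Category.assoc] at h
  exact congrArg (fun r ↦ r.hom a) h

/-- This matches evaluation at the generic point with the description of sections as an integral
closure; injectivity and the image of `sectionsToField` are read off from it. -/
lemma sectionsToField_eq {U : X.Opens} (hU : IsAffineOpen U) [Nonempty U]
    (b : Γ(normalizationIn X L, normalizationMap X L ⁻¹ᵁ U)) :
    letI := ((specExtension X L).app U).hom.toAlgebra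
    sectionsToField X L U b = (preimageSectionsEquiv X L U).hom
      (((specExtension X L).normalizationObjIso hU).hom b).1 := by
  have h := (specExtension X L).normalizationObjIso_hom_val hU
  have h2 : sectionsToField X L U = ((specExtension X L).toNormalization.appLE
      ((specExtension X L).fromNormalization ⁻¹ᵁ U) (specExtension X L ⁻¹ᵁ U)
      (by rw [← Scheme.Hom.comp_preimage, Scheme.Hom.toNormalization_fromNormalization]) ≫
      (preimageSectionsEquiv X L U).hom).hom := by
    rw [preimageSectionsEquiv, Iso.trans_hom, Functor.mapIso_hom, Scheme.Hom.appLE_map_assoc]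
    rfl
  rw [h2, ← h]
  rfl

lemma sectionsToField_injective {U : X.Opens} (hU : IsAffineOpen U) [Nonempty U] :
    Function.Injective (sectionsToField X L U) := by
  intro b b' hb
  rw [sectionsToField_eq X L hU, sectionsToField_eq X L hU] at hb
  have h1 := (ConcreteCategory.bijective_of_isIso (preimageSectionsEquiv X L U).hom).1 hb
  exact (ConcreteCategory.bijective_of_isIso ((specExtension X L).normalizationObjIso hU).hom).1
    (Subtype.ext h1)

lemma exists_sectionsToField_eq {U : X.Opens} (hU : IsAffineOpen U) [Nonempty U] {l : L}
    (hl : ((algebraMap X.functionField L).comp (algebraMap Γ(X, U) X.functionField)).IsIntegralElem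
      l) : ∃ b, sectionsToField X L U b = l := by
  let : Algebra Γ(X, U) Γ(Spec (.of L), specExtension X L ⁻¹ᵁ U) :=
    ((specExtension X L).app U).hom.toAlgebra
  let : Algebra Γ(X, U) L :=
    ((algebraMap X.functionField L).comp (algebraMap Γ(X, U) X.functionField)).toAlgebra
  obtain ⟨w, rfl⟩ := (ConcreteCategory.bijective_of_isIso (preimageSectionsEquiv X L U).hom).2 l
  let ρ : Γ(Spec (.of L), specExtension X L ⁻¹ᵁ U) →ₐ[Γ(X, U)] L :=
    { (preimageSectionsEquiv X L U).hom.hom with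
      commutes' := fun a ↦ preimageSectionsEquiv_app X L U a }
  have hw : _root_.IsIntegral Γ(X, U) w := (isIntegral_algHom_iff ρ
    (ConcreteCategory.bijective_of_isIso (preimageSectionsEquiv X L U).hom).1).mp hl
  obtain ⟨b, hb⟩ := (ConcreteCategory.bijective_of_isIso
    ((specExtension X L).normalizationObjIso hU).hom).2 ⟨w, hw⟩
  exact ⟨b, (sectionsToField_eq X L hU b).trans
    (congrArg (fun z ↦ (preimageSectionsEquiv X L U).hom z.1) hb)⟩

lemma isIntegralClosure_sections {U : X.Opens} (hU : IsAffineOpen U) [Nonempty U] :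
    letI : Algebra Γ(X, U) Γ(normalizationIn X L, normalizationMap X L ⁻¹ᵁ U) :=
      ((normalizationMap X L).app U).hom.toAlgebra
    letI : Algebra Γ(normalizationIn X L, normalizationMap X L ⁻¹ᵁ U) L :=
      (sectionsToField X L U).toAlgebra
    letI : Algebra Γ(X, U) L :=
      ((algebraMap X.functionField L).comp (algebraMap Γ(X, U) X.functionField)).toAlgebra
    IsIntegralClosure Γ(normalizationIn X L, normalizationMap X L ⁻¹ᵁ U) Γ(X, U) L := by
  let : Algebra Γ(X, U) Γ(normalizationIn X L, normalizationMap X L ⁻¹ᵁ U) :=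
    ((normalizationMap X L).app U).hom.toAlgebra
  let : Algebra Γ(normalizationIn X L, normalizationMap X L ⁻¹ᵁ U) L :=
    (sectionsToField X L U).toAlgebra
  let : Algebra Γ(X, U) L :=
    ((algebraMap X.functionField L).comp (algebraMap Γ(X, U) X.functionField)).toAlgebra
  refine ⟨sectionsToField_injective X L hU, fun {l} ↦ ⟨exists_sectionsToField_eq X L hU, ?_⟩⟩
  rintro ⟨b, rfl⟩
  have h1 : _root_.IsIntegral Γ(X, U) b := IsIntegralHom.isIntegral_app (normalizationMap X L) U hU b
  have : IsScalarTower Γ(X, U) Γ(normalizationIn X L, normalizationMap X L ⁻¹ᵁ U) L :=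
    .of_algebraMap_eq fun a ↦ (sectionsToField_app X L U a).symm
  exact h1.algebraMap

end Sections

end

end LocalKernels

namespace LocalKernels

noncomputable section

open TensorProduct IsLocalRing

/-! ### Étaleness of the normalization in a field extension -/

lemma isIntegrallyClosed_sections {X : Scheme.{u}} [IsIntegral X]
    (hX : ∀ x : X, IsIntegrallyClosed (X.presheaf.stalk x)) {U : X.Opens} (hU : IsAffineOpen U)
    [Nonempty U] : IsIntegrallyClosed Γ(X, U) := by
  refine .of_localization_maximal fun P _ hP ↦ ?_
  have hmem : hU.fromSpec ⟨P, hP.isPrime⟩ ∈ U := hU.range_fromSpec.le ⟨_, rfl⟩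
  let : Algebra Γ(X, U) (X.presheaf.stalk (hU.fromSpec ⟨P, hP.isPrime⟩)) :=
    X.presheaf.algebra_section_stalk ⟨_, hmem⟩
  have : IsLocalization.AtPrime (X.presheaf.stalk (hU.fromSpec ⟨P, hP.isPrime⟩)) P :=
    hU.isLocalization_stalk' ⟨P, hP.isPrime⟩ hmem
  have := hX (hU.fromSpec ⟨P, hP.isPrime⟩)
  exact .of_equiv (IsLocalization.algEquiv P.primeCompl
    (X.presheaf.stalk (hU.fromSpec ⟨P, hP.isPrime⟩)) (Localization.AtPrime P)).toRingEquiv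

/-- Over nonempty affines this is the finiteness of the integral closure of a noetherian normal
domain in a finite separable extension. -/
lemma isFinite_normalizationMap (X : Scheme.{u}) [IsIntegral X] [IsLocallyNoetherian X]
    (hX : ∀ x : X, IsIntegrallyClosed (X.presheaf.stalk x)) (L : Type u) [Field L]
    [Algebra X.functionField L] [FiniteDimensional X.functionField L]
    [Algebra.IsSeparable X.functionField L] : IsFinite (normalizationMap X L) := by
  refine ⟨fun U hU ↦ ?_⟩
  obtain hU' | hU' := isEmpty_or_nonempty U
  · have : U = ⊥ := by
      rw [eq_bot_iff]
      exact fun x hx ↦ (hU'.false ⟨x, hx⟩).elim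
    subst this
    have : Subsingleton Γ(normalizationIn X L, normalizationMap X L ⁻¹ᵁ ⊥) :=
      inferInstanceAs (Subsingleton Γ(normalizationIn X L, ⊥))
    exact RingHom.Finite.of_surjective _ fun b ↦ ⟨0, Subsingleton.elim _ _⟩
  · let : Algebra Γ(X, U) Γ(normalizationIn X L, normalizationMap X L ⁻¹ᵁ U) :=
      ((normalizationMap X L).app U).hom.toAlgebra
    let : Algebra Γ(normalizationIn X L, normalizationMap X L ⁻¹ᵁ U) L :=
      (sectionsToField X L U).toAlgebra
    let : Algebra Γ(X, U) L :=
      ((algebraMap X.functionField L).comp (algebraMap Γ(X, U) X.functionField)).toAlgebra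
    have : IsScalarTower Γ(X, U) X.functionField L := .of_algebraMap_eq' rfl
    have : IsScalarTower Γ(X, U) Γ(normalizationIn X L, normalizationMap X L ⁻¹ᵁ U) L :=
      .of_algebraMap_eq fun a ↦ (sectionsToField_app X L U a).symm
    have := isIntegralClosure_sections X L hU
    have := isIntegrallyClosed_sections hX hU
    have := functionField_isFractionRing_of_isAffineOpen X U hU
    have : IsNoetherianRing Γ(X, U) := IsLocallyNoetherian.component_noetherian ⟨U, hU⟩
    exact (IsIntegralClosure.finite Γ(X, U) X.functionField L
      Γ(normalizationIn X L, normalizationMap X L ⁻¹ᵁ U) : Module.Finite _ _)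

/-- By integrality the point is closed in the affine open `g ⁻¹ᵁ U`. Its specializations in `Y`
still lie over the closed point `x`, so they do not leave that open set. This makes the hypothesis
on closed points of the normalization available. -/
lemma isClosed_singleton_fromSpec {X Y : Scheme.{u}} (g : Y ⟶ X) [IsIntegralHom g] {U : X.Opens}
    (hU : IsAffineOpen U) {x : X} (hx : x ∈ U) (hxcl : IsClosed ({x} : Set X))
    (Q : Spec Γ(Y, g ⁻¹ᵁ U)) (hQ : Spec.map (g.app U) Q = hU.primeIdealOf ⟨x, hx⟩) :
    IsClosed ({(hU.preimage g).fromSpec Q} : Set Y) := by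
  have hcomap : (PrimeSpectrum.asIdeal Q).comap (g.app U).hom =
      (hU.primeIdealOf ⟨x, hx⟩).asIdeal := congrArg PrimeSpectrum.asIdeal hQ
  have : (PrimeSpectrum.asIdeal Q).IsPrime := PrimeSpectrum.isPrime Q
  have hmax : (PrimeSpectrum.asIdeal Q).IsMaximal :=
    Ideal.isMaximal_of_isIntegral_of_isMaximal_comap' _ (IsIntegralHom.isIntegral_app g U hU) _
      (hcomap ▸ hU.primeIdealOf_isMaximal_of_isClosed ⟨x, hx⟩ hxcl)
  have hQcl : IsClosed ({Q} : Set (Spec Γ(Y, g ⁻¹ᵁ U))) :=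
    (PrimeSpectrum.isClosed_singleton_iff_isMaximal Q).mpr hmax
  have hgQ : g ((hU.preimage g).fromSpec Q) = x := by
    have h1 := hU.SpecMap_appLE_fromSpec g (hU.preimage g) le_rfl
    rw [Scheme.Hom.appLE_eq_app] at h1
    rw [← Scheme.Hom.comp_apply, ← h1, Scheme.Hom.comp_apply, hQ]
    exact hU.fromSpec_primeIdealOf ⟨x, hx⟩
  have hemb := (hU.preimage g).fromSpec.isOpenEmbedding
  rw [← closure_subset_iff_isClosed]
  intro z hz
  have hgz : g z = x := by
    have h1 : g z ∈ closure {x} := by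
      rw [← hgQ, ← Set.image_singleton (f := g)]
      exact image_closure_subset_closure_image g.continuous ⟨z, hz, rfl⟩
    rwa [hxcl.closure_eq] at h1
  have hzU : z ∈ g ⁻¹ᵁ U := by
    change g z ∈ U
    rwa [hgz]
  obtain ⟨q, rfl⟩ := (hU.preimage g).range_fromSpec.ge hzU
  have h2 : q ∈ closure {Q} := by
    rw [hemb.isInducing.closure_eq_preimage_closure_image, Set.image_singleton]
    exact hz
  rw [hQcl.closure_eq] at h2
  rw [Set.mem_singleton_iff.mp h2]
  rfl

/-! ### Étaleness of the normalization, from closed points to all points. -/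

section Etale

variable (X : Scheme.{u}) [IsIntegral X] [IsLocallyNoetherian X]
  (L : Type u) [Field L] [Algebra X.functionField L] [FiniteDimensional X.functionField L]
  [Algebra.IsSeparable X.functionField L] [HasNormalCompletions X]
  [HasNormalCompletions (normalizationIn X L)]

lemma isEtaleAt_sections (hX : ∀ x : X, IsIntegrallyClosed (X.presheaf.stalk x))
    (x : ClosedPoint X) {U : X.Opens} (hU : IsAffineOpen U)
    (hx : x.1 ∈ U) (Ω : Type u) [Field Ω] [Algebra (CompletedField X x.1) Ω]
    [IsAlgClosure (CompletedField X x.1) Ω] [Algebra (CompletedStalk X x.1) Ω]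
    [IsScalarTower (CompletedStalk X x.1) (CompletedField X x.1) Ω]
    (h : ∀ τ : L →+* Ω, τ.comp (algebraMap X.functionField L) =
      (algebraMap (CompletedField X x.1) Ω).comp (functionFieldToCompletedField X x.1) →
      ∀ l, IsUnramifiedSet (CompletedStalk X x.1) (CompletedField X x.1) Ω {τ l})
    (Q : PrimeSpectrum Γ(normalizationIn X L, normalizationMap X L ⁻¹ᵁ U))
    (hQ : Q.asIdeal.comap ((normalizationMap X L).app U).hom ≤
      (hU.primeIdealOf ⟨x.1, hx⟩).asIdeal) :
    letI := ((normalizationMap X L).app U).hom.toAlgebra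
    Algebra.IsEtaleAt Γ(X, U) Q.asIdeal := by
  have : Nonempty U := ⟨⟨x.1, hx⟩⟩
  let : Algebra Γ(X, U) Γ(normalizationIn X L, normalizationMap X L ⁻¹ᵁ U) :=
    ((normalizationMap X L).app U).hom.toAlgebra
  let : Algebra Γ(normalizationIn X L, normalizationMap X L ⁻¹ᵁ U) L :=
    (sectionsToField X L U).toAlgebra
  let : Algebra Γ(X, U) L :=
    ((algebraMap X.functionField L).comp (algebraMap Γ(X, U) X.functionField)).toAlgebra
  have : IsScalarTower Γ(X, U) X.functionField L := .of_algebraMap_eq' rfl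
  have : IsScalarTower Γ(X, U) Γ(normalizationIn X L, normalizationMap X L ⁻¹ᵁ U) L :=
    .of_algebraMap_eq fun a ↦ (sectionsToField_app X L U a).symm
  have := isIntegralClosure_sections X L hU
  have := isIntegrallyClosed_sections hX hU
  have := functionField_isFractionRing_of_isAffineOpen X U hU
  have : IsNoetherianRing Γ(X, U) := IsLocallyNoetherian.component_noetherian ⟨U, hU⟩
  let : Algebra Γ(X, U) (X.presheaf.stalk x.1) := X.presheaf.algebra_section_stalk ⟨x.1, hx⟩
  have : IsScalarTower Γ(X, U) (X.presheaf.stalk x.1) X.functionField :=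
    functionField_isScalarTower X U ⟨x.1, hx⟩
  have : IsLocalization.AtPrime (X.presheaf.stalk x.1) (hU.primeIdealOf ⟨x.1, hx⟩).asIdeal :=
    hU.isLocalization_stalk ⟨x.1, hx⟩
  let : Algebra X.functionField (CompletedField X x.1) :=
    (functionFieldToCompletedField X x.1).toAlgebra
  have : IsScalarTower (X.presheaf.stalk x.1) X.functionField (CompletedField X x.1) :=
    .of_algebraMap_eq fun a ↦ (functionFieldToCompletedField_algebraMap X x.1 a).symm
  let : Algebra X.functionField Ω :=
    ((algebraMap (CompletedField X x.1) Ω).comp (functionFieldToCompletedField X x.1)).toAlgebra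
  have : IsScalarTower X.functionField (CompletedField X x.1) Ω := .of_algebraMap_eq' rfl
  refine isEtaleAt_of_completion (hU.primeIdealOf ⟨x.1, hx⟩).asIdeal (R := X.presheaf.stalk x.1)
    X.functionField L ?_ (CompletedField X x.1) Ω (fun τ l ↦ h τ τ.comp_algebraMap l) _ hQ
  intro Q' _ hQ'
  have hV := hU.preimage (normalizationMap X L)
  have hcl := isClosed_singleton_fromSpec (normalizationMap X L) hU hx x.2 ⟨Q', inferInstance⟩
    (PrimeSpectrum.ext hQ')
  have hmem : hV.fromSpec ⟨Q', inferInstance⟩ ∈ normalizationMap X L ⁻¹ᵁ U :=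
    hV.range_fromSpec.le ⟨_, rfl⟩
  let : Algebra Γ(normalizationIn X L, normalizationMap X L ⁻¹ᵁ U)
      ((normalizationIn X L).presheaf.stalk (hV.fromSpec ⟨Q', inferInstance⟩)) :=
    (normalizationIn X L).presheaf.algebra_section_stalk ⟨_, hmem⟩
  have : IsLocalization.AtPrime ((normalizationIn X L).presheaf.stalk
      (hV.fromSpec ⟨Q', inferInstance⟩)) Q' := hV.isLocalization_stalk' ⟨Q', inferInstance⟩ hmem
  exact ⟨(normalizationIn X L).presheaf.stalk (hV.fromSpec ⟨Q', inferInstance⟩), inferInstance,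
    inferInstance, (IsLocalization.algEquiv Q'.primeCompl (Localization.AtPrime Q')
      ((normalizationIn X L).presheaf.stalk (hV.fromSpec ⟨Q', inferInstance⟩))).toRingEquiv,
    HasNormalCompletions.isDomain ⟨_, hcl⟩, HasNormalCompletions.isIntegrallyClosed ⟨_, hcl⟩⟩

theorem etale_normalizationMap [CompactSpace X]
    (hX : ∀ x : X, IsIntegrallyClosed (X.presheaf.stalk x))
    (Ω : ClosedPoint X → Type u) [∀ x, Field (Ω x)]
    [∀ x : ClosedPoint X, Algebra (CompletedField X x.1) (Ω x)]
    [∀ x : ClosedPoint X, IsAlgClosure (CompletedField X x.1) (Ω x)]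
    [∀ x : ClosedPoint X, Algebra (CompletedStalk X x.1) (Ω x)]
    [∀ x : ClosedPoint X, IsScalarTower (CompletedStalk X x.1) (CompletedField X x.1) (Ω x)]
    (h : ∀ x (τ : L →+* Ω x), τ.comp (algebraMap X.functionField L) =
      (algebraMap (CompletedField X x.1) (Ω x)).comp (functionFieldToCompletedField X x.1) →
      ∀ l, IsUnramifiedSet (CompletedStalk X x.1) (CompletedField X x.1) (Ω x) {τ l}) :
    Etale (normalizationMap X L) := by
  have hloc : RingHom.HoldsForLocalizationAway @RingHom.Etale :=
    RingHom.Etale.propertyIsLocal.HoldsForLocalizationAway RingHom.Etale.containsIdentities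
  rw [HasRingHomProperty.iff_exists_appLE (P := @Etale)
    (RingHom.Etale.stableUnderComposition.stableUnderCompositionWithLocalizationAway hloc).1]
  intro y
  -- By quasi-compactness the image of `y` specializes to a closed point `x`, and étaleness over the
  -- local ring at `x` already covers `y`.
  obtain ⟨x, hxy, hx⟩ := (isClosed_closure (s := {normalizationMap X L y})).exists_closed_singleton
    (Set.singleton_nonempty _).closure
  have hspec : normalizationMap X L y ⤳ x := specializes_iff_mem_closure.mpr hxy
  obtain ⟨_, ⟨U, hU, rfl⟩, hxU, -⟩ :=
    X.isBasis_affineOpens.exists_subset_of_mem_open (Set.mem_univ x) isOpen_univ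
  replace hU : IsAffineOpen U := hU
  have hyU : normalizationMap X L y ∈ U := hspec.mem_open U.isOpen hxU
  have hV := hU.preimage (normalizationMap X L)
  let Q : PrimeSpectrum Γ(normalizationIn X L, normalizationMap X L ⁻¹ᵁ U) :=
    hV.primeIdealOf ⟨y, hyU⟩
  have hQy : hV.fromSpec Q = y := hV.fromSpec_primeIdealOf ⟨y, hyU⟩
  let : Algebra Γ(X, U) Γ(normalizationIn X L, normalizationMap X L ⁻¹ᵁ U) :=
    ((normalizationMap X L).app U).hom.toAlgebra
  have hQ : Q.asIdeal.comap ((normalizationMap X L).app U).hom ≤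
      (hU.primeIdealOf ⟨x, hxU⟩).asIdeal := by
    have h1 := hU.comap_primeIdealOf_appLE (f := normalizationMap X L) U _ hV le_rfl hyU
    rw [Scheme.Hom.appLE_eq_app] at h1
    have h2 : hU.primeIdealOf ⟨normalizationMap X L y, hyU⟩ ⤳ hU.primeIdealOf ⟨x, hxU⟩ :=
      hU.fromSpec.isOpenEmbedding.isInducing.specializes_iff.mp
        ((specializes_of_eq (hU.fromSpec_primeIdealOf ⟨_, hyU⟩)).trans
          (hspec.trans (specializes_of_eq (hU.fromSpec_primeIdealOf ⟨x, hxU⟩).symm)))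
    have h3 := (PrimeSpectrum.le_iff_specializes _ _).mpr h2
    rw [← h1] at h3
    exact h3
  have het : Algebra.IsEtaleAt Γ(X, U) Q.asIdeal :=
    isEtaleAt_sections X L hX ⟨x, hx⟩ hU hxU (Ω ⟨x, hx⟩) (h ⟨x, hx⟩) Q hQ
  have : IsNoetherianRing Γ(X, U) := IsLocallyNoetherian.component_noetherian ⟨U, hU⟩
  have : Module.Finite Γ(X, U) Γ(normalizationIn X L, normalizationMap X L ⁻¹ᵁ U) :=
    (isFinite_normalizationMap X hX L).finite_app U hU
  have : Algebra.FinitePresentation Γ(X, U) Γ(normalizationIn X L, normalizationMap X L ⁻¹ᵁ U) :=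
    Algebra.FinitePresentation.of_finiteType.mp inferInstance
  -- Finite presentation spreads étaleness at `Q` to a basic open neighbourhood.
  obtain ⟨f, hf, hf'⟩ := Algebra.exists_etale_of_isEtaleAt (R := Γ(X, U)) Q.asIdeal
  have hyf : y ∈ (normalizationIn X L).basicOpen f := by
    rw [← hQy]
    have : (show Spec Γ(normalizationIn X L, normalizationMap X L ⁻¹ᵁ U) from Q) ∈ hV.fromSpec ⁻¹ᵁ (normalizationIn X L).basicOpen f := by
      rw [hV.fromSpec_preimage_basicOpen]
      exact hf
    exact this
  refine ⟨⟨U, hU⟩, ⟨_, hV.basicOpen f⟩, hyf, (normalizationIn X L).basicOpen_le f, ?_⟩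
  have := hV.isLocalization_basicOpen f
  let : Algebra Γ(X, U) Γ(normalizationIn X L, (normalizationIn X L).basicOpen f) :=
    ((normalizationMap X L).appLE U _ ((normalizationIn X L).basicOpen_le f)).hom.toAlgebra
  have : IsScalarTower Γ(X, U) Γ(normalizationIn X L, normalizationMap X L ⁻¹ᵁ U)
    Γ(normalizationIn X L, (normalizationIn X L).basicOpen f) := .of_algebraMap_eq' rfl
  exact Algebra.Etale.of_equiv ((IsLocalization.algEquiv (Submonoid.powers f)
    (Localization.Away f)
    Γ(normalizationIn X L, (normalizationIn X L).basicOpen f)).restrictScalars Γ(X, U))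

end Etale

end

end LocalKernels

namespace LocalKernels

noncomputable section

/-! ### The closure of a subgroup of the Galois group of a normal extension -/

/-- In the automorphism group of a normal extension, the closure of a subgroup contains every
element fixing all separable elements that are fixed by the subgroup. -/
lemma mem_topologicalClosure_of_forall {K Ω : Type*} [Field K] [Field Ω] [Algebra K Ω]
    [Normal K Ω] (N : Subgroup Gal(Ω/K)) (σ : Gal(Ω/K))
    (h : ∀ c : Ω, IsSeparable K c → (∀ n ∈ N, n c = c) → σ c = c) :
    σ ∈ N.topologicalClosure := by
  change σ ∈ closure (N : Set Gal(Ω/K))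
  rw [mem_closure_iff_nhds]
  intro t ht
  have ht' : (fun g ↦ σ * g) ⁻¹' t ∈ nhds (1 : Gal(Ω/K)) :=
    (continuous_const_mul σ).continuousAt.preimage_mem_nhds (by simpa using ht)
  -- It is enough to find an element of `N` agreeing with `σ` on the finite normal subextension `E`.
  obtain ⟨E, _, _, hE⟩ := (krullTopology_mem_nhds_one_iff_of_normal K Ω _).mp ht'
  suffices hσ : AlgEquiv.restrictNormalHom E σ ∈ N.map (AlgEquiv.restrictNormalHom E) by
    obtain ⟨n, hn, hnσ⟩ := hσ
    refine ⟨n, ?_, hn⟩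
    have h1 : σ⁻¹ * n ∈ E.fixingSubgroup := by
      rw [IntermediateField.mem_fixingSubgroup_iff]
      intro e he
      have h2 := congrArg (fun g : Gal(E/K) ↦ (g ⟨e, he⟩ : Ω)) hnσ
      have h3 := AlgEquiv.restrictNormal_commutes n E ⟨e, he⟩
      have h4 := AlgEquiv.restrictNormal_commutes σ E ⟨e, he⟩
      have h5 : n e = σ e := h3.symm.trans (h2.trans h4)
      rw [AlgEquiv.mul_apply, h5]
      exact σ.symm_apply_apply e
    simpa using hE h1
  -- A subgroup of the finite group `Gal(E/K)` is recovered from its fixed field, even when `E` is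
  -- inseparable over `K`.
  rw [← IntermediateField.fixingSubgroup_fixedField (N.map (AlgEquiv.restrictNormalHom E)),
    IntermediateField.mem_fixingSubgroup_iff]
  intro e he
  let q := ringExpChar K
  have : ExpChar Ω q := expChar_of_injective_algebraMap (algebraMap K Ω).injective q
  have : Algebra.IsAlgebraic K Ω := Normal.toIsAlgebraic
  -- `e` may be inseparable, so the hypothesis is applied to a separable `q`-power of it;
  -- injectivity of Frobenius then gives back `e`.
  obtain ⟨m, ⟨s, hs⟩, hm⟩ := IsPurelyInseparable.pow_mem (separableClosure K Ω) q (e : Ω)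
  have hsep : IsSeparable K ((e : Ω) ^ q ^ m) := by
    rw [← hm]
    exact mem_separableClosure_iff.mp hs
  have hfix (n : Gal(Ω/K)) (hn : n ∈ N) : n ((e : Ω) ^ q ^ m) = (e : Ω) ^ q ^ m := by
    have h1 := he ⟨AlgEquiv.restrictNormalHom E n, Subgroup.mem_map_of_mem _ hn⟩
    have h2 := AlgEquiv.restrictNormal_commutes n E e
    rw [map_pow]
    congr 1
    exact h2.symm.trans (congrArg Subtype.val h1)
  have h1 := h _ hsep hfix
  rw [map_pow] at h1
  have h2 : σ e = e := iterateFrobenius_inj Ω q m h1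
  exact Subtype.ext ((AlgEquiv.restrictNormal_commutes σ E e).trans h2)

/-! ### Automorphisms in the kernel fix the fields with étale normalization -/

/-- `τ` is a point in the fibre of the finite étale normalization, so `σ` fixes it. Since `L` is the
fraction field of the sections over an affine open, the point determines `τ`. -/
lemma apply_eq_of_mem_ker (X : Scheme.{u}) [IsIntegral X] [IsLocallyNoetherian X] (L : Type u)
    [Field L] [Algebra X.functionField L] [FiniteDimensional X.functionField L]
    [IsFinite (normalizationMap X L)] [Etale (normalizationMap X L)]
    (Ω : Type u) [Field Ω] [Algebra X.functionField Ω] {σ : Gal(Ω/X.functionField)}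
    (hσ : σ ∈ (galToPi1 (specFunctionField X) Ω).ker) (τ : L →ₐ[X.functionField] Ω) (l : L) :
    σ (τ l) = τ l := by
  rw [mem_ker_galToPi1_iff] at hσ
  have h1 := hσ _ (normalizationMap X L)
    (Spec.map (CommRingCat.ofHom (τ : L →+* Ω)) ≫ toNormalizationIn X L) <| by
      rw [Category.assoc, toNormalizationIn_normalizationMap, geometricPoint, specExtension,
        ← Spec.map_comp_assoc, ← CommRingCat.ofHom_comp]
      congr 3
      exact τ.comp_algebraMap
  rw [← Spec.map_comp_assoc, ← CommRingCat.ofHom_comp] at h1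
  obtain ⟨_, ⟨U, hU, rfl⟩, hxU, -⟩ := X.isBasis_affineOpens.exists_subset_of_mem_open
    (Set.mem_univ (genericPoint X)) isOpen_univ
  replace hU : IsAffineOpen U := hU
  have : Nonempty U := ⟨⟨_, hxU⟩⟩
  have key (ρ : L →+* Ω) (e) : (Spec.map (CommRingCat.ofHom ρ) ≫ toNormalizationIn X L).appLE
      (normalizationMap X L ⁻¹ᵁ U) ⊤ e ≫ (Scheme.ΓSpecIso (.of Ω)).hom =
      CommRingCat.ofHom (ρ.comp (sectionsToField X L U)) := by
    have h2 := Scheme.Hom.appLE_comp_appLE (Spec.map (CommRingCat.ofHom ρ)) (toNormalizationIn X L)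
      (normalizationMap X L ⁻¹ᵁ U) ⊤ ⊤ (top_le_toNormalizationIn_preimage X L U) le_top
    have h3 : (Spec.map (CommRingCat.ofHom ρ)).appLE ⊤ ⊤ le_top =
      (Spec.map (CommRingCat.ofHom ρ)).appTop := Scheme.Hom.appLE_eq_app _
    rw [← h2, Category.assoc, h3, Scheme.ΓSpecIso_naturality]
    rfl
  have e (ρ : L →+* Ω) : ⊤ ≤ (Spec.map (CommRingCat.ofHom ρ) ≫ toNormalizationIn X L) ⁻¹ᵁ
      (normalizationMap X L ⁻¹ᵁ U) :=
    fun z _ ↦ top_le_toNormalizationIn_preimage X L U (Set.mem_univ _)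
  have h4 := congrArg (· ≫ (Scheme.ΓSpecIso (.of Ω)).hom) (appLE_congr_hom h1 (e _) (e _))
  rw [key, key] at h4
  replace h4 := congrArg CommRingCat.Hom.hom h4
  let : Algebra Γ(X, U) Γ(normalizationIn X L, normalizationMap X L ⁻¹ᵁ U) :=
    ((normalizationMap X L).app U).hom.toAlgebra
  let : Algebra Γ(normalizationIn X L, normalizationMap X L ⁻¹ᵁ U) L :=
    (sectionsToField X L U).toAlgebra
  let : Algebra Γ(X, U) L :=
    ((algebraMap X.functionField L).comp (algebraMap Γ(X, U) X.functionField)).toAlgebra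
  have : IsScalarTower Γ(X, U) X.functionField L := .of_algebraMap_eq' rfl
  have : IsScalarTower Γ(X, U) Γ(normalizationIn X L, normalizationMap X L ⁻¹ᵁ U) L :=
    .of_algebraMap_eq fun a ↦ (sectionsToField_app X L U a).symm
  have := isIntegralClosure_sections X L hU
  have := functionField_isFractionRing_of_isAffineOpen X U hU
  have : IsDomain Γ(normalizationIn X L, normalizationMap X L ⁻¹ᵁ U) :=
    (sectionsToField_injective X L hU).isDomain
  have := IsIntegralClosure.isFractionRing_of_finite_extension Γ(X, U) X.functionField L
    Γ(normalizationIn X L, normalizationMap X L ⁻¹ᵁ U)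
  have h5 : (σ : Ω →+* Ω).comp (τ : L →+* Ω) = (τ : L →+* Ω) := IsLocalization.ringHom_ext
    (nonZeroDivisors Γ(normalizationIn X L, normalizationMap X L ⁻¹ᵁ U)) h4
  exact congrArg (fun ρ : L →+* Ω ↦ ρ l) h5

end

end LocalKernels

namespace LocalKernels

noncomputable section

/-! ### Fields fixed by the local kernels -/

/-- If the subfield `L` of `Kbar` is fixed by a normal subgroup containing the image of the kernel
at `x`, then all embeddings of `L` over the completed field have unramified values. -/
lemma isUnramifiedSet_of_fixed (X : Scheme.{u}) [IsIntegral X] [IsLocallyNoetherian X] (x : X)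
    [IsDomain (CompletedStalk X x)] [IsIntegrallyClosed (CompletedStalk X x)]
    (Kbar : Type u) [Field Kbar] [Algebra X.functionField Kbar] [IsAlgClosure X.functionField Kbar]
    (Ω : Type u) [Field Ω] [Algebra (CompletedField X x) Ω]
    [IsAlgClosure (CompletedField X x) Ω] [Algebra (CompletedStalk X x) Ω]
    [IsScalarTower (CompletedStalk X x) (CompletedField X x) Ω] (ω : Kbar →+* Ω)
    (hω : ω.comp (algebraMap X.functionField Kbar) =
      (algebraMap (CompletedField X x) Ω).comp (functionFieldToCompletedField X x))
    (N : Subgroup Gal(Kbar/X.functionField)) [N.Normal]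
    (hN : ∀ s ∈ (galToPi1 (specCompletedField X x) Ω).ker,
      galRestrict (functionFieldToCompletedField X x) ω hω s ∈ N)
    (L : IntermediateField X.functionField Kbar) [Algebra.IsSeparable X.functionField L]
    (hL : ∀ n ∈ N, ∀ l ∈ L, n l = l) (τ : L →+* Ω) (hτ : τ.comp (algebraMap X.functionField L) =
      (algebraMap (CompletedField X x) Ω).comp (functionFieldToCompletedField X x)) (l : L) :
    IsUnramifiedSet (CompletedStalk X x) (CompletedField X x) Ω {τ l} := by
  let : Algebra X.functionField (CompletedField X x) :=
    (functionFieldToCompletedField X x).toAlgebra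
  let : Algebra X.functionField Ω :=
    ((algebraMap (CompletedField X x) Ω).comp (functionFieldToCompletedField X x)).toAlgebra
  have : IsScalarTower X.functionField (CompletedField X x) Ω := .of_algebraMap_eq' rfl
  let : Algebra Kbar Ω := ω.toAlgebra
  have : IsScalarTower X.functionField Kbar Ω := .of_algebraMap_eq' hω.symm
  have : IsAlgClosed Kbar := IsAlgClosure.isAlgClosed X.functionField
  have : Normal X.functionField Kbar := IsAlgClosure.normal _ _
  let τ' : L →ₐ[X.functionField] Ω := { τ with commutes' := fun a ↦ congrArg (fun r ↦ r a) hτ }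
  have hsep : IsSeparable X.functionField (τ' l) :=
    (Algebra.IsSeparable.isSeparable X.functionField l).map τ' τ'.injective
  have hint : _root_.IsIntegral Kbar (τ' l) := hsep.isIntegral.tower_top
  -- `τ l` is algebraic over the algebraically closed field `Kbar`, so it equals `ω a`; then `a` is
  -- a conjugate of `l` over `K`.
  obtain ⟨a, ha⟩ := minpoly.mem_range_of_degree_eq_one Kbar (τ' l)
    (IsAlgClosed.degree_eq_one_of_irreducible _ (minpoly.irreducible hint))
  have hroot : Polynomial.aeval a (minpoly X.functionField (l : Kbar)) = 0 := by
    apply (algebraMap Kbar Ω).injective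
    rw [map_zero, ← Polynomial.aeval_algebraMap_apply, ha, ← IntermediateField.minpoly_eq,
      Polynomial.aeval_algHom_apply, minpoly.aeval, map_zero]
  obtain ⟨g, hg⟩ := minpoly.exists_algEquiv_of_root
    (Algebra.IsAlgebraic.isAlgebraic (R := X.functionField) (l : Kbar)) hroot
  refine isUnramifiedSet_of_forall_fixed (hsep.tower_top _) fun s hs ↦ ?_
  have hs' := hN s (mem_ker_galToPi1_of_forall_etale s hs)
  have h1 : galRestrict (functionFieldToCompletedField X x) ω hω s a = a := by
    -- `τ` need not agree with `ω` on `L`. With `l = g a`, the conjugate by `g` of the restricted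
    -- automorphism lies in `N` and fixes `l`, so the restricted automorphism fixes `a`.
    have h2 := hL _ (‹N.Normal›.conj_mem _ hs' g) l l.2
    rw [← hg, AlgEquiv.mul_apply, AlgEquiv.mul_apply] at h2
    have h3 : g⁻¹ (g a) = a := g.symm_apply_apply a
    rw [h3] at h2
    exact g.injective h2
  have h4 := galRestrict_apply (functionFieldToCompletedField X x) ω hω s a
  rw [h1] at h4
  have h5 : τ l = ω a := ha.symm
  rw [h5, ← h4]

end

end LocalKernels

/-! ### The equality of the global kernel with the closed normal subgroup generated by the local
kernels. -/

theorem mainTheorem3 (X : Scheme.{u}) [IsIntegral X] [IsNoetherian X]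
    (hX : ∀ x : X, IsIntegrallyClosed (X.presheaf.stalk x))
    [LocalKernels.HasNormalCompletions X]
    (hL : ∀ (L : Type u) [Field L] [Algebra X.functionField L]
      [FiniteDimensional X.functionField L] [Algebra.IsSeparable X.functionField L],
      LocalKernels.HasNormalCompletions (LocalKernels.normalizationIn X L))
    (Kbar : Type u) [Field Kbar] [Algebra X.functionField Kbar]
    [IsAlgClosure X.functionField Kbar]
    (Kbarx : LocalKernels.ClosedPoint X → Type u) [∀ x, Field (Kbarx x)]
    [∀ x : LocalKernels.ClosedPoint X, Algebra (LocalKernels.CompletedField X x.1) (Kbarx x)]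
    [∀ x : LocalKernels.ClosedPoint X, IsAlgClosure (LocalKernels.CompletedField X x.1) (Kbarx x)]
    (ω : ∀ x : LocalKernels.ClosedPoint X, Kbar →+* Kbarx x)
    (hω : ∀ x : LocalKernels.ClosedPoint X,
      (ω x).comp (algebraMap X.functionField Kbar) =
        (algebraMap (LocalKernels.CompletedField X x.1) (Kbarx x)).comp
          (LocalKernels.functionFieldToCompletedField X x.1)) :
    (LocalKernels.galToPi1 (LocalKernels.specFunctionField X) Kbar).ker =
      (Subgroup.normalClosure (⋃ x : LocalKernels.ClosedPoint X,
        LocalKernels.galRestrict (LocalKernels.functionFieldToCompletedField X x.1) (ω x) (hω x) ''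
          ((LocalKernels.galToPi1 (LocalKernels.specCompletedField X x.1) (Kbarx x)).ker :
            Set Gal(Kbarx x/LocalKernels.CompletedField X x.1)))).topologicalClosure := by
  have : Normal X.functionField Kbar := IsAlgClosure.normal _ _
  have : Algebra.IsAlgebraic X.functionField Kbar := Normal.toIsAlgebraic
  apply le_antisymm
  · intro σ hσ
    refine LocalKernels.mem_topologicalClosure_of_forall _ σ fun c hsep hc ↦ ?_
    have : FiniteDimensional X.functionField (IntermediateField.adjoin X.functionField {c}) :=
      IntermediateField.adjoin.finiteDimensional hsep.isIntegral
    have : Algebra.IsSeparable X.functionField (IntermediateField.adjoin X.functionField {c}) :=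
      (IntermediateField.isSeparable_adjoin_simple_iff_isSeparable _ _).mpr hsep
    have := hL (IntermediateField.adjoin X.functionField {c})
    have := LocalKernels.isFinite_normalizationMap X hX
      (IntermediateField.adjoin X.functionField {c})
    let (x : LocalKernels.ClosedPoint X) : Algebra (LocalKernels.CompletedStalk X x.1) (Kbarx x) :=
      ((algebraMap (LocalKernels.CompletedField X x.1) (Kbarx x)).comp
        (algebraMap (LocalKernels.CompletedStalk X x.1) _)).toAlgebra
    have (x : LocalKernels.ClosedPoint X) : IsScalarTower (LocalKernels.CompletedStalk X x.1)
      (LocalKernels.CompletedField X x.1) (Kbarx x) := .of_algebraMap_eq' rfl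
    have : Etale (LocalKernels.normalizationMap X
        (IntermediateField.adjoin X.functionField {c})) := by
      refine LocalKernels.etale_normalizationMap X _ hX Kbarx fun x τ hτ l ↦ ?_
      have hfix := fun n hn l hl ↦ (IntermediateField.mem_fixingSubgroup_iff _ _).mp
        ((LocalKernels.mem_fixingSubgroup_adjoin_simple_iff c n).mpr (hc n hn)) l hl
      refine LocalKernels.isUnramifiedSet_of_fixed X x.1 Kbar (Kbarx x) (ω x) (hω x) _ ?_
        _ hfix τ hτ l
      exact fun s hs ↦ Subgroup.subset_normalClosure (Set.mem_iUnion.mpr ⟨x, s, hs, rfl⟩)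
    exact LocalKernels.apply_eq_of_mem_ker X (IntermediateField.adjoin X.functionField {c}) Kbar
      hσ (IntermediateField.val _) ⟨c, IntermediateField.mem_adjoin_simple_self _ c⟩
  · refine Subgroup.topologicalClosure_minimal _ (Subgroup.normalClosure_le_normal ?_)
      (LocalKernels.isClosed_ker_galToPi1 _ _)
    rintro _ ⟨_, ⟨x, rfl⟩, s, hs, rfl⟩
    exact LocalKernels.galRestrict_mem_ker _ _ _ _ _ (hω x)
      (LocalKernels.specMap_functionFieldToCompletedField X x.1) hs
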